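/- Let $0<p_B<p_A<1$, $\pi=p_A-p_B$ and $x\in(0,1)$. Let $(U_n)_{n\ge1}$ be independent random variables uniformly distributed on $[0,1]$, and let $(A_n)_{n\ge1},(B_n)_{n\ge1}$ be events with $P(A_n)=p_A$, $P(B_n)=p_B$, such that the sequence $(U_n)_{n\ge1}$ is independent of the sequence $(\mathbf 1_{A_n},\mathbf 1_{B_n})_{n\ge1}$, and such that, for every $n\ge0$, each of the events $A_{n+1}$ and $B_{n+1}$ is independent of $(\mathbf 1_{A_k},\mathbf 1_{B_k})_{1\le k\le n}$ (this holds in particular if the pairs $(\mathbf 1_{A_n},\mathbf 1_{B_n})$, $n\ge1$, are independent). Let $(\gamma_n)_{n\ge1}$ be a non-increasing sequence in $(0,1)$ with $\sum_n\gamma_n=\infty$ and $\sum_n e^{-\vartheta/\gamma_n}<\infty$ for all $\vartheta>0$, and let $(\rho_n)_{n\ge1}$ be a sequence of positive numbers with $\gamma_n\rho_n<1$ for all $n$. Define $X_0=x$ and, for $n\ge0$, $$X_{n+1}=X_n+\gamma_{n+1}\left(\mathbf 1_{\{U_{n+1}\le X_n\}\cap A_{n+1}}(1-X_n)-\mathbf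 1_{\{U_{n+1}>X_n\}\cap B_{n+1}}X_n\right)-\gamma_{n+1}\rho_{n+1}\left(X_n\mathbf 1_{\{U_{n+1}\le X_n\}\cap A_{n+1}^c}-(1-X_n)\mathbf 1_{\{U_{n+1}>X_n\}\cap B_{n+1}^c}\right).$$ Assume that, as $n\to\infty$, (i) $\rho_n\to0$, $\gamma_n/\rho_n\to0$, $\sum_n\rho_n\gamma_n=\infty$ and $\rho_n-\rho_{n-1}=o(\rho_n\gamma_n)$; (ii) for all $\beta\in[0,1]$, $\gamma_n\rho_n^\beta-\gamma_{n-1}\rho_{n-1}^\beta=o(\gamma_n^2\rho_n^\beta)$; (iii) for some $\eta>0$, $\sum_n\exp\left(-c\,\rho_n^{1+\eta}/\gamma_n\right)<\infty$ for all $c>0$. Then, with probability $1$, $$\lim_{n\to\infty}\frac{1-X_n}{\rho_n}=\frac{1-p_A}{\pi}.$$ Moreover, if $\gamma_n=Cn^{-a}$ and $\rho_n=C'n^{-r}$ for $n\ge1$, with $C,C'>0$, $0<r<a$ and $a+r<1$, then (i), (ii) and (iii) hold; if in addition $C<1$ and $CC'<1$, then $(\gamma_n)$ and $(\rho_n)$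 also satisfy all the assumptions made on them before (i). -/

import Mathlib

open MeasureTheory ProbabilityTheory Filter Topology Asymptotics

namespace LRP

/-- Indicator function of an event, with real values `0` and `1`. -/
noncomputable def ind {Ω : Type*} (E : Set Ω) : Ω → ℝ := E.indicator 1

/-- The penalized two-armed bandit (linear reward-penalty) algorithm started at `x`, with reward
rates `γ n`, penalty rates `γ n * ρ n`, selection variables `U n` and success events `A n`, `B n`.
All these sequences are indexed by `n ≥ 1`; their entries at `0` are never used. -/
noncomputable def X {Ω : Type*} (γ ρ : ℕ → ℝ) (U : ℕ → Ω → ℝ) (A B : ℕ → Set Ω) (x : ℝ) :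
    ℕ → Ω → ℝ
  | 0 => fun _ => x
  | n + 1 => fun ω =>
      X γ ρ U A B x n ω
        + γ (n + 1) *
          (ind ({ω' | U (n + 1) ω' ≤ X γ ρ U A B x n ω'} ∩ A (n + 1)) ω
              * (1 - X γ ρ U A B x n ω)
            - ind ({ω' | X γ ρ U A B x n ω' < U (n + 1) ω'} ∩ B (n + 1)) ω
              * X γ ρ U A B x n ω)
        - γ (n + 1) * ρ (n + 1) *
          (X γ ρ U A B x n ω
              * ind ({ω' | U (n + 1) ω' ≤ X γ ρ U A B x n ω'} ∩ (A (n + 1))ᶜ) ω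
            - (1 - X γ ρ U A B x n ω)
              * ind ({ω' | X γ ρ U A B x n ω' < U (n + 1) ω'} ∩ (B (n + 1))ᶜ) ω)

/-- Standing assumptions on the random inputs `(U n, A n, B n)`, `n ≥ 1`. -/
structure IsInput {Ω : Type*} [MeasurableSpace Ω] (μ : Measure Ω) (U : ℕ → Ω → ℝ)
    (A B : ℕ → Set Ω) (pA pB : ℝ) : Prop where
  measurable_U : ∀ n, 1 ≤ n → Measurable (U n)
  measurableSet_A : ∀ n, 1 ≤ n → MeasurableSet (A n)
  measurableSet_B : ∀ n, 1 ≤ n → MeasurableSet (B n)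
  /-- Each `U n` is uniform on `[0, 1]`. -/
  uniform_U : ∀ n, 1 ≤ n → pdf.IsUniform (U n) (Set.Icc 0 1) μ volume
  /-- The `U n` are independent. -/
  indep_U : iIndepFun (fun n : ℕ => U (n + 1)) μ
  prob_A : ∀ n, 1 ≤ n → μ.real (A n) = pA
  prob_B : ∀ n, 1 ≤ n → μ.real (B n) = pB
  /-- The sequence `(U n)` is independent of the sequence `(1_{A n}, 1_{B n})`. -/
  indep_U_AB : IndepFun (fun ω (n : ℕ) => U (n + 1) ω)
    (fun ω (n : ℕ) => (ind (A (n + 1)) ω, ind (B (n + 1)) ω)) μ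
  /-- `A (n + 1)` is independent of the past performances `(1_{A k}, 1_{B k})`, `1 ≤ k ≤ n`. -/
  indep_A_past : ∀ n : ℕ, IndepFun (ind (A (n + 1)))
    (fun ω (k : Fin n) => (ind (A (k + 1)) ω, ind (B (k + 1)) ω)) μ
  /-- `B (n + 1)` is independent of the past performances `(1_{A k}, 1_{B k})`, `1 ≤ k ≤ n`. -/
  indep_B_past : ∀ n : ℕ, IndepFun (ind (B (n + 1)))
    (fun ω (k : Fin n) => (ind (A (k + 1)) ω, ind (B (k + 1)) ω)) μ

/-- Standing assumptions on the rate sequences `(γ n)` and `(ρ n)`, `n ≥ 1`. -/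
structure IsRate (γ ρ : ℕ → ℝ) : Prop where
  γ_pos : ∀ n, 1 ≤ n → 0 < γ n
  γ_lt_one : ∀ n, 1 ≤ n → γ n < 1
  γ_anti : ∀ m n, 1 ≤ m → m ≤ n → γ n ≤ γ m
  sum_γ : Tendsto (fun N => ∑ n ∈ Finset.Icc 1 N, γ n) atTop atTop
  sum_exp : ∀ ϑ : ℝ, 0 < ϑ → Summable (fun n : ℕ => Real.exp (-ϑ / γ (n + 1)))
  ρ_pos : ∀ n, 1 ≤ n → 0 < ρ n
  γρ_lt_one : ∀ n, 1 ≤ n → γ n * ρ n < 1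

/-- `ρ n → 0`, `γ n / ρ n → 0`, `∑ ρ n γ n = ∞` and `ρ n - ρ (n - 1) = o(ρ n γ n)`. -/
structure RhoConditions (γ ρ : ℕ → ℝ) : Prop where
  tendsto_ρ : Tendsto ρ atTop (𝓝 0)
  tendsto_ratio : Tendsto (fun n => γ n / ρ n) atTop (𝓝 0)
  sum_ργ : Tendsto (fun N => ∑ n ∈ Finset.Icc 1 N, ρ n * γ n) atTop atTop
  ρ_increment : (fun n : ℕ => ρ (n + 1) - ρ n) =o[atTop] fun n : ℕ => ρ (n + 1) * γ (n + 1)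

/-- `γ n ρ n ^ β - γ (n - 1) ρ (n - 1) ^ β = o(γ n ^ 2 ρ n ^ β)` for every `β ∈ [0, 1]`. -/
def RegularityCondition (γ ρ : ℕ → ℝ) : Prop :=
  ∀ β ∈ Set.Icc (0 : ℝ) 1,
    (fun n : ℕ => γ (n + 1) * ρ (n + 1) ^ β - γ n * ρ n ^ β)
      =o[atTop] fun n : ℕ => γ (n + 1) ^ 2 * ρ (n + 1) ^ β

/-- For some `η > 0`, `∑ exp (-c ρ n ^ (1 + η) / γ n) < ∞` for every `c > 0`. -/
def ExpSumCondition (γ ρ : ℕ → ℝ) : Prop :=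
  ∃ η : ℝ, 0 < η ∧ ∀ c : ℝ, 0 < c →
    Summable (fun n : ℕ => Real.exp (-c * (ρ (n + 1) ^ (1 + η) / γ (n + 1))))

end LRP

/-!
Write `π = pA - pB` and let `D` be the martingale increment of the algorithm, so that
`X (n + 1) = X n + γ (n + 1) * (drift (X n) + D (n + 1))` with drift
`π X (1 - X) + ρ ((1 - X)² (1 - pB) - X² (1 - pA))`. Near `1` the drift of `1 - X` is
`-π (1 - X) + ρ (1 - pA)` to first order, so `(1 - X) / ρ` should settle at `(1 - pA) / π` as soon
as the noise is negligible at scale `ρ`.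

*Removing the noise.* Let `N` be the discounted average
`N (n + 1) = (1 - γ (n + 1)) * N n + γ (n + 1) * D (n + 1)`. Then `X - N` follows the recursion of
`X` with `D (n + 1)` replaced by `N n`, so once `N` is known to be small the problem is
deterministic, path by path.

*Size of the noise.* The conditional variance of `D` is at most `X (1 - X) + ρ²`. If only the noise
met while `X (1 - X) ≤ ρ ^ β` is filtered, induction on `n` bounds the exponential moments of `N n`
by those of a Gaussian of variance of order `γ ρ ^ β` (`IsInput.integral_exp_filteredNoise_le`); the
regularity of `γ ρ ^ β` is what closes the induction. Chernoff's bound and the Borel-Cantelli lemma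
then give `N = o(ρ ^ β')` almost surely when `2 β' - β ≤ 1 + η`
(`IsInput.ae_tendsto_filteredNoise`). One round is integrated out with
`IsInput.integral_mul_exp_outcome_le`, which only uses that the next selection variable together
with a single one of the events `A (n + 1)`, `B (n + 1)` is independent of the past.

*Deterministic part* (`IsPath.tendsto`). With `N → 0`, every path converges to `0` or to `1`. Since
`2 β' - β ≤ 1 + η` allows `β' > β`, the distance to the limit can be improved from `O(ρ ^ β)` to
`o(ρ ^ β')` in finitely many steps `β = k / m`, `β' = (k + 1) / m`. At the repulsive point `0` this
ends in a contradiction at `β' = 1`, where the penalty pushes the path away at scale `ρ`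
(`tendsto_zero_of_unstable`). At the attractive point `1` the recursion for `(1 - X) / ρ ^ β'` is
stable, and at `β' = 1` its equilibrium is `(1 - pA) / π` (`tendsto_of_stable_recursion`).
-/

namespace LRP

/-! ### Linear recursions with vanishing steps -/

lemma sum_Icc_one_succ (γ : ℕ → ℝ) (n : ℕ) :
    ∑ k ∈ Finset.Icc 1 (n + 1), γ k = ∑ k ∈ Finset.Icc 1 n, γ k + γ (n + 1) :=
  Finset.sum_Icc_succ_top (by omega) _

/-- A linear recursion with contraction rate at least `c γ`, where `∑ γ = ∞`, forgets its initial
value and averages out a vanishing forcing term. -/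
lemma tendsto_zero_of_contracting {γ a b w : ℕ → ℝ} {c M : ℝ} (hγ : ∀ᶠ n in atTop, 0 ≤ γ n)
    (hγ0 : Tendsto γ atTop (𝓝 0))
    (hS : Tendsto (fun N => ∑ n ∈ Finset.Icc 1 N, γ n) atTop atTop) (hc : 0 < c)
    (ha : ∀ᶠ n in atTop, c ≤ a n ∧ a n ≤ M) (hb : Tendsto b atTop (𝓝 0))
    (hw : ∀ᶠ n in atTop, w (n + 1) = (1 - γ (n + 1) * a n) * w n + γ (n + 1) * b n) :
    Tendsto w atTop (𝓝 0) := by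
  rw [Metric.tendsto_nhds]
  intro ε hε
  have hγ1 : ∀ᶠ n in atTop, 0 ≤ γ (n + 1) := (tendsto_add_atTop_nat 1).eventually hγ
  have hγM : ∀ᶠ n in atTop, γ (n + 1) * M < 1 := by
    have := ((tendsto_add_atTop_iff_nat 1).2 hγ0).mul_const M
    rw [zero_mul] at this
    exact this.eventually (gt_mem_nhds one_pos)
  have hb' : ∀ᶠ n in atTop, |b n| < c * (ε / 2) := by
    have := hb.abs
    rw [abs_zero] at this
    exact this.eventually (gt_mem_nhds (by positivity))
  obtain ⟨n0, h0⟩ := eventually_atTop.1 (hγ1.and (hγM.and (hb'.and (ha.and hw))))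
  set S : ℕ → ℝ := fun N => ∑ n ∈ Finset.Icc 1 N, γ n with hSdef
  -- the excess of `|w|` over `ε / 2`; weighted by `exp (c S)` it is nonincreasing
  set T : ℕ → ℝ := fun n => max (|w n| - ε / 2) 0 with hT
  have hstep : ∀ n, n0 ≤ n → T (n + 1) * Real.exp (c * S (n + 1)) ≤ T n * Real.exp (c * S n) := by
    intro n hn
    obtain ⟨h1, h2, h3, ⟨h4, h4'⟩, h5⟩ := h0 n hn
    have hT0 : 0 ≤ T n := le_max_right _ _
    have hTn : |w n| - ε / 2 ≤ T n := le_max_left _ _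
    have hga : γ (n + 1) * a n ≤ 1 := by nlinarith
    have hgc : γ (n + 1) * c ≤ γ (n + 1) * a n := mul_le_mul_of_nonneg_left h4 h1
    have hw1 : |w (n + 1)| ≤ (1 - γ (n + 1) * c) * |w n| + γ (n + 1) * (c * (ε / 2)) := by
      rw [h5]
      refine (abs_add_le _ _).trans ?_
      rw [abs_mul, abs_mul, abs_of_nonneg h1, abs_of_nonneg (by linarith : 0 ≤ 1 - γ (n + 1) * a n)]
      gcongr
    have hT1 : T (n + 1) ≤ (1 - γ (n + 1) * c) * T n := by
      have : 0 ≤ 1 - γ (n + 1) * c := by linarith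
      refine max_le ?_ (mul_nonneg this hT0)
      nlinarith [mul_le_mul_of_nonneg_left hTn this]
    have hexp : 1 - γ (n + 1) * c ≤ Real.exp (-(c * γ (n + 1))) := by
      have := Real.add_one_le_exp (-(c * γ (n + 1)))
      linarith
    have hSs : S (n + 1) = S n + γ (n + 1) := sum_Icc_one_succ γ n
    calc T (n + 1) * Real.exp (c * S (n + 1))
        ≤ (Real.exp (-(c * γ (n + 1))) * T n) * Real.exp (c * S (n + 1)) := by
          gcongr
          exact hT1.trans (mul_le_mul_of_nonneg_right hexp hT0)
      _ = T n * (Real.exp (-(c * γ (n + 1))) * Real.exp (c * S (n + 1))) := by ring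
      _ = T n * Real.exp (c * S n) := by
          rw [← Real.exp_add, hSs]
          ring_nf
  have hbound : ∀ n, n0 ≤ n → T n ≤ (T n0 * Real.exp (c * S n0)) * Real.exp (-(c * S n)) := by
    intro n hn
    have : T n * Real.exp (c * S n) ≤ T n0 * Real.exp (c * S n0) := by
      induction n, hn using Nat.le_induction with
      | base => exact le_rfl
      | succ k hk ih => exact (hstep k hk).trans ih
    rw [Real.exp_neg, ← div_eq_mul_inv, le_div_iff₀ (Real.exp_pos _)]
    exact this
  have hlim : Tendsto (fun n => (T n0 * Real.exp (c * S n0)) * Real.exp (-(c * S n))) atTop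
      (𝓝 0) := by
    have := (Real.tendsto_exp_neg_atTop_nhds_zero.comp (hS.const_mul_atTop hc)).const_mul
      (T n0 * Real.exp (c * S n0))
    rwa [mul_zero] at this
  filter_upwards [hlim.eventually (gt_mem_nhds (half_pos hε)), eventually_ge_atTop n0] with n h1 h2
  have h3 := hbound n h2
  have h4 : |w n| - ε / 2 ≤ T n := le_max_left _ _
  rw [Real.dist_eq, sub_zero]
  linarith

/-- A stable linear recursion converges to the zero of its limiting affine drift. -/
lemma tendsto_of_stable_recursion {γ a b w : ℕ → ℝ} {a₀ b₀ : ℝ} (hγ : ∀ᶠ n in atTop, 0 ≤ γ n)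
    (hγ0 : Tendsto γ atTop (𝓝 0))
    (hS : Tendsto (fun N => ∑ n ∈ Finset.Icc 1 N, γ n) atTop atTop) (ha₀ : a₀ < 0)
    (ha : Tendsto a atTop (𝓝 a₀)) (hb : Tendsto b atTop (𝓝 b₀))
    (hw : ∀ᶠ n in atTop, w (n + 1) = w n + γ (n + 1) * (a n * w n + b n)) :
    Tendsto w atTop (𝓝 (-b₀ / a₀)) := by
  have key : Tendsto (fun n => w n - (-b₀ / a₀)) atTop (𝓝 0) := by
    refine tendsto_zero_of_contracting (γ := γ) (a := fun n => - a n)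
      (b := fun n => b n + a n * (-b₀ / a₀)) (c := - a₀ / 2) (M := - a₀ * 2) hγ hγ0 hS
      (by linarith) ?_ ?_ ?_
    · filter_upwards [ha.eventually (gt_mem_nhds (by linarith : a₀ < a₀ / 2)),
        ha.eventually (lt_mem_nhds (by linarith : a₀ * 2 < a₀))] with n h1 h2
      constructor <;> linarith
    · have := hb.add (ha.mul_const (-b₀ / a₀))
      have h0 : b₀ + a₀ * (-b₀ / a₀) = 0 := by rw [mul_div_cancel₀ _ ha₀.ne]; ring
      rwa [h0] at this
    · filter_upwards [hw] with n hn
      rw [hn]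
      ring
  have := key.add_const (-b₀ / a₀)
  simpa using this

/-- A linear recursion with divergent total step cannot converge to `0` against a positive forcing
term. -/
lemma forcing_eq_zero_of_tendsto_zero {γ a b w : ℕ → ℝ} {a₀ b₀ : ℝ}
    (hγ : ∀ᶠ n in atTop, 0 ≤ γ n)
    (hS : Tendsto (fun N => ∑ n ∈ Finset.Icc 1 N, γ n) atTop atTop)
    (ha : Tendsto a atTop (𝓝 a₀)) (hb : Tendsto b atTop (𝓝 b₀)) (hb₀ : 0 ≤ b₀)
    (hw : ∀ᶠ n in atTop, w (n + 1) = w n + γ (n + 1) * (a n * w n + b n))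
    (hw0 : Tendsto w atTop (𝓝 0)) : b₀ = 0 := by
  by_contra hne
  have hpos : 0 < b₀ := lt_of_le_of_ne hb₀ (Ne.symm hne)
  have hlim : Tendsto (fun n => a n * w n + b n) atTop (𝓝 b₀) := by
    have := (ha.mul hw0).add hb
    rwa [mul_zero, zero_add] at this
  have hγ1 : ∀ᶠ n in atTop, 0 ≤ γ (n + 1) := (tendsto_add_atTop_nat 1).eventually hγ
  obtain ⟨n0, h0⟩ := eventually_atTop.1
    (hγ1.and ((hlim.eventually (lt_mem_nhds (by linarith : b₀ / 2 < b₀))).and hw))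
  set S : ℕ → ℝ := fun N => ∑ n ∈ Finset.Icc 1 N, γ n with hSdef
  have hge : ∀ n, n0 ≤ n → w n0 + b₀ / 2 * (S n - S n0) ≤ w n := by
    intro n hn
    induction n, hn using Nat.le_induction with
    | base => simp
    | succ k hk ih =>
      obtain ⟨h1, h2, h3⟩ := h0 k hk
      have hSs : S (k + 1) = S k + γ (k + 1) := sum_Icc_one_succ γ k
      rw [h3, hSs]
      nlinarith [mul_le_mul_of_nonneg_left h2.le h1]
  have htop : Tendsto w atTop atTop := by
    refine tendsto_atTop_mono' atTop
      ((eventually_ge_atTop n0).mono fun n hn => hge n hn) ?_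
    exact tendsto_atTop_add_const_left _ _
      ((tendsto_atTop_add_const_right _ (-S n0) hS).const_mul_atTop (by linarith))
  exact not_tendsto_nhds_of_tendsto_atTop htop 0 hw0

/-! ### Rates and recursions at scale `ρ ^ β` -/

section Rates

variable {γ ρ : ℕ → ℝ}

lemma IsRate.eventually_γ_pos (hr : IsRate γ ρ) : ∀ᶠ n in atTop, 0 < γ n :=
  (eventually_ge_atTop 1).mono hr.γ_pos

lemma IsRate.eventually_ρ_pos (hr : IsRate γ ρ) : ∀ᶠ n in atTop, 0 < ρ n :=
  (eventually_ge_atTop 1).mono hr.ρ_pos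

lemma RhoConditions.tendsto_γ (hr : IsRate γ ρ) (hρ : RhoConditions γ ρ) :
    Tendsto γ atTop (𝓝 0) := by
  have := hρ.tendsto_ratio.mul hρ.tendsto_ρ
  rw [zero_mul] at this
  refine this.congr' ?_
  filter_upwards [hr.eventually_ρ_pos] with n hn
  exact div_mul_cancel₀ _ hn.ne'

lemma abs_rpow_sub_one_le {r β : ℝ} (hr : 0 < r) (h0 : 0 ≤ β) (h1 : β ≤ 1) :
    |r ^ β - 1| ≤ |r - 1| := by
  rcases le_total 1 r with h | h
  · have e1 : 1 ≤ r ^ β := Real.one_le_rpow h h0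
    have e2 : r ^ β ≤ r := by
      simpa using Real.rpow_le_rpow_of_exponent_le h h1
    rw [abs_of_nonneg (by linarith), abs_of_nonneg (by linarith)]
    linarith
  · have e1 : r ^ β ≤ 1 := Real.rpow_le_one hr.le h h0
    have e2 : r ≤ r ^ β := by
      simpa using Real.rpow_le_rpow_of_exponent_ge hr h h1
    rw [abs_of_nonpos (by linarith), abs_of_nonpos (by linarith)]
    linarith

lemma RhoConditions.tendsto_rpow_ratio (hr : IsRate γ ρ) (hρ : RhoConditions γ ρ) {β : ℝ}
    (h0 : 0 ≤ β) (h1 : β ≤ 1) :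
    Tendsto (fun n => ((ρ n / ρ (n + 1)) ^ β - 1) / γ (n + 1)) atTop (𝓝 0) := by
  have h := hρ.ρ_increment.tendsto_div_nhds_zero.abs
  rw [abs_zero] at h
  refine squeeze_zero_norm' ?_ h
  filter_upwards [eventually_ge_atTop 1] with n hn
  have a1 := hr.ρ_pos n hn
  have a2 := hr.ρ_pos (n + 1) (by omega)
  have a3 := hr.γ_pos (n + 1) (by omega)
  have e : (ρ (n + 1) - ρ n) / (ρ (n + 1) * γ (n + 1))
      = -((ρ n / ρ (n + 1) - 1) / γ (n + 1)) := by
    field_simp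
    ring
  rw [e, abs_neg, Real.norm_eq_abs, abs_div, abs_div]
  exact div_le_div_of_nonneg_right (abs_rpow_sub_one_le (div_pos a1 a2) h0 h1) (abs_nonneg _)

lemma RhoConditions.tendsto_rpow_ratio_one (hr : IsRate γ ρ) (hρ : RhoConditions γ ρ) {β : ℝ}
    (h0 : 0 ≤ β) (h1 : β ≤ 1) :
    Tendsto (fun n => (ρ n / ρ (n + 1)) ^ β) atTop (𝓝 1) := by
  have hg := (tendsto_add_atTop_iff_nat 1).2 (hρ.tendsto_γ hr)
  have := ((hρ.tendsto_rpow_ratio hr h0 h1).mul hg).add_const 1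
  rw [zero_mul, zero_add] at this
  refine this.congr fun n => ?_
  have a3 := hr.γ_pos (n + 1) (by omega)
  field_simp
  ring

/-- Along `ρ n ^ β` a null sequence relative to index `n` is null relative to index `n + 1`. -/
lemma RhoConditions.tendsto_div_succ (hr : IsRate γ ρ) (hρ : RhoConditions γ ρ) {β : ℝ}
    (h0 : 0 ≤ β) (h1 : β ≤ 1) {N : ℕ → ℝ} (hN : Tendsto (fun n => N n / ρ n ^ β) atTop (𝓝 0)) :
    Tendsto (fun n => N n / ρ (n + 1) ^ β) atTop (𝓝 0) := by
  have := hN.mul (hρ.tendsto_rpow_ratio_one hr h0 h1)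
  rw [zero_mul] at this
  refine this.congr' ?_
  filter_upwards [eventually_ge_atTop 1] with n hn
  have a1 := hr.ρ_pos n hn
  have a2 := hr.ρ_pos (n + 1) (by omega)
  rw [Real.div_rpow a1.le a2.le]
  have := Real.rpow_pos_of_pos a1 β
  have := Real.rpow_pos_of_pos a2 β
  field_simp

/-- Since `ρ` varies slowly on the time scale of `γ`, dividing by `ρ ^ β` does not change the
leading coefficient of a linear recursion. -/
lemma exists_normalized_recursion (hr : IsRate γ ρ) (hρ : RhoConditions γ ρ) {β a₀ : ℝ}
    (h0 : 0 ≤ β) (h1 : β ≤ 1) {Y a s : ℕ → ℝ} (ha : Tendsto a atTop (𝓝 a₀))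
    (hY : ∀ᶠ n in atTop, Y (n + 1) = Y n + γ (n + 1) * (a n * Y n + s n)) :
    ∃ a' : ℕ → ℝ, Tendsto a' atTop (𝓝 a₀) ∧ ∀ᶠ n in atTop, Y (n + 1) / ρ (n + 1) ^ β
      = Y n / ρ n ^ β + γ (n + 1) * (a' n * (Y n / ρ n ^ β) + s n / ρ (n + 1) ^ β) := by
  set d : ℕ → ℝ := fun n => ((ρ n / ρ (n + 1)) ^ β - 1) / γ (n + 1) with hd
  have hdlim : Tendsto d atTop (𝓝 0) := hρ.tendsto_rpow_ratio hr h0 h1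
  have hg := (tendsto_add_atTop_iff_nat 1).2 (hρ.tendsto_γ hr)
  refine ⟨fun n => a n + d n + γ (n + 1) * (a n * d n), ?_, ?_⟩
  · have := (ha.add hdlim).add (hg.mul (ha.mul hdlim))
    simpa using this
  · filter_upwards [hY, eventually_ge_atTop 1] with n hn hn1
    have a1 := hr.ρ_pos n hn1
    have a2 := hr.ρ_pos (n + 1) (by omega)
    have a3 := hr.γ_pos (n + 1) (by omega)
    have b1 := Real.rpow_pos_of_pos a1 β
    have b2 := Real.rpow_pos_of_pos a2 β
    rw [hn, hd]
    simp only
    rw [Real.div_rpow a1.le a2.le]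
    field_simp
    ring

/-- Near the repulsive equilibrium: if `Y` follows an unstable linear recursion, stays
asymptotically nonnegative at scale `ρ ^ β` and still tends to `0`, then it is negligible at scale
`ρ ^ β`, and the forcing has no component at that scale. -/
lemma tendsto_zero_of_unstable (hr : IsRate γ ρ) (hρ : RhoConditions γ ρ) {β a₀ b₀ : ℝ}
    (h0 : 0 ≤ β) (h1 : β ≤ 1) {Y a s : ℕ → ℝ} (ha₀ : 0 < a₀) (hb₀ : 0 ≤ b₀)
    (ha : Tendsto a atTop (𝓝 a₀))
    (hs : Tendsto (fun n => s n / ρ (n + 1) ^ β) atTop (𝓝 b₀))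
    (hY : ∀ᶠ n in atTop, Y (n + 1) = Y n + γ (n + 1) * (a n * Y n + s n))
    (hlow : ∀ ε : ℝ, 0 < ε → ∀ᶠ n in atTop, -ε < Y n / ρ n ^ β)
    (hY0 : Tendsto Y atTop (𝓝 0)) :
    Tendsto (fun n => Y n / ρ n ^ β) atTop (𝓝 0) ∧ b₀ = 0 := by
  obtain ⟨a', ha', hw⟩ := exists_normalized_recursion hr hρ h0 h1 ha hY
  have hγ1 : ∀ᶠ n in atTop, 0 ≤ γ (n + 1) :=
    Eventually.of_forall fun n => (hr.γ_pos (n + 1) (by omega)).le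
  have hup : ∀ ε : ℝ, 0 < ε → ∀ᶠ n in atTop, Y n / ρ n ^ β < ε := by
    intro ε hε
    by_contra hcon
    have hfreq : ∃ᶠ n in atTop, ε ≤ Y n / ρ n ^ β := by
      refine (not_eventually.1 hcon).mono fun n hn => not_lt.1 hn
    have e1 := ha.eventually (lt_mem_nhds (by linarith : a₀ / 2 < a₀))
    have e2 := ha'.eventually (lt_mem_nhds (by linarith : a₀ / 2 < a₀))
    have e3 := hs.eventually (lt_mem_nhds (by nlinarith : -(a₀ * ε / 4) < b₀))
    have e4 := (hρ.tendsto_rpow_ratio_one hr h0 h1).eventually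
      (lt_mem_nhds (by norm_num : (1 / 2 : ℝ) < 1))
    obtain ⟨n0, hn0⟩ := eventually_atTop.1
      (e1.and (e2.and (e3.and (e4.and (hw.and (hY.and (hγ1.and (eventually_ge_atTop 1))))))))
    obtain ⟨m, hm, hmε⟩ := frequently_atTop.1 hfreq n0
    -- once the normalized path is above `ε`, it stays there and the path itself cannot decrease
    have hstay : ∀ n, m ≤ n → ε ≤ Y n / ρ n ^ β ∧ Y m ≤ Y n := by
      intro n hn
      induction n, hn using Nat.le_induction with
      | base => exact ⟨hmε, le_rfl⟩
      | succ k hk ih =>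
        obtain ⟨f1, f2, f3, f4, f5, f6, f7, f8⟩ := hn0 k (hm.trans hk)
        have a1 := hr.ρ_pos k f8
        have a2 := hr.ρ_pos (k + 1) (by omega)
        have b1 := Real.rpow_pos_of_pos a1 β
        have b2 := Real.rpow_pos_of_pos a2 β
        rw [Real.div_rpow a1.le a2.le, lt_div_iff₀ b2] at f4
        obtain ⟨i1, i2⟩ := ih
        constructor
        · rw [f5]
          have : 0 ≤ a' k * (Y k / ρ k ^ β) + s k / ρ (k + 1) ^ β := by
            nlinarith
          nlinarith
        · rw [le_div_iff₀ b1] at i1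
          rw [lt_div_iff₀ b2] at f3
          have g1 : ε * ρ k ^ β * (a₀ / 2) ≤ a k * Y k := by
            have : 0 < ε * ρ k ^ β := by positivity
            nlinarith
          have g2 : a₀ * ε / 4 * ρ (k + 1) ^ β ≤ a₀ * ε / 4 * (2 * ρ k ^ β) := by
            gcongr
            linarith
          have : 0 ≤ a k * Y k + s k := by nlinarith
          rw [f6]
          nlinarith [mul_nonneg f7 this]
    have hYm : 0 < Y m := by
      have a1 := hr.ρ_pos m (hn0 m hm).2.2.2.2.2.2.2
      have b1 := Real.rpow_pos_of_pos a1 β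
      rw [le_div_iff₀ b1] at hmε
      have : 0 < ε * ρ m ^ β := by positivity
      linarith
    have : Y m ≤ 0 := ge_of_tendsto hY0 ((eventually_ge_atTop m).mono fun n hn => (hstay n hn).2)
    linarith
  have hw0 : Tendsto (fun n => Y n / ρ n ^ β) atTop (𝓝 0) := by
    rw [Metric.tendsto_nhds]
    intro ε hε
    filter_upwards [hup ε hε, hlow ε hε] with n h2 h3
    rw [Real.dist_eq, sub_zero, abs_lt]
    exact ⟨h3, h2⟩
  exact ⟨hw0, forcing_eq_zero_of_tendsto_zero (hr.eventually_γ_pos.mono fun n h => h.le) hr.sum_γ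
    ha' hs hb₀ hw hw0⟩

end Rates

/-! ### Trajectories driven by filtered noise -/

/-- The drift contributed by the penalties, per unit of `γ n * ρ n`. -/
def penaltyDrift (pA pB x : ℝ) : ℝ := (1 - x) ^ 2 * (1 - pB) - x ^ 2 * (1 - pA)

/-- Conditional mean of `(X (n + 1) - X n) / γ (n + 1)` given `X n = x`, where `r` stands for
`ρ (n + 1)`. -/
def drift (pA pB r x : ℝ) : ℝ := (pA - pB) * (x * (1 - x)) + r * penaltyDrift pA pB x

lemma continuous_penaltyDrift (pA pB : ℝ) : Continuous (penaltyDrift pA pB) := by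
  unfold penaltyDrift
  fun_prop

/-- A trajectory `x` in `[0, 1]` of the recursion driven by the noise sequence `D`. -/
structure IsPath (γ ρ : ℕ → ℝ) (pA pB : ℝ) (x D : ℕ → ℝ) : Prop where
  nonneg : ∀ n, 0 ≤ x n
  le_one : ∀ n, x n ≤ 1
  succ : ∀ n, x (n + 1) = x n + γ (n + 1) * (drift pA pB (ρ (n + 1)) (x n) + D (n + 1))

/-- `N` is, from some index on, the exponentially discounted average of the noise `D`. -/
def IsNoiseFilter (γ D N : ℕ → ℝ) : Prop :=
  ∀ᶠ n in atTop, N (n + 1) = (1 - γ (n + 1)) * N n + γ (n + 1) * D (n + 1)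

section Path

variable {γ ρ x D N : ℕ → ℝ} {pA pB : ℝ}

lemma RhoConditions.tendsto_div_rpow (hr : IsRate γ ρ) (hρ : RhoConditions γ ρ) {β : ℝ}
    (h1 : β ≤ 1) :
    Tendsto (fun n => ρ (n + 1) / ρ (n + 1) ^ β) atTop (𝓝 (if β = 1 then 1 else 0)) := by
  have hp : ∀ n, 0 < ρ (n + 1) := fun n => hr.ρ_pos (n + 1) (by omega)
  have e : (fun n => ρ (n + 1) / ρ (n + 1) ^ β) = fun n => ρ (n + 1) ^ (1 - β) := by
    funext n
    rw [Real.rpow_sub (hp n), Real.rpow_one]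
  rw [e]
  split_ifs with h
  · simp [h]
  · have hlt : 0 < 1 - β := by
      have := lt_of_le_of_ne h1 h
      linarith
    have h0 := (tendsto_add_atTop_iff_nat 1).2 hρ.tendsto_ρ
    have := h0.rpow_const (p := 1 - β) (Or.inr hlt.le)
    rwa [Real.zero_rpow hlt.ne'] at this

lemma RhoConditions.tendsto_zero_of_div_rpow (hr : IsRate γ ρ) (hρ : RhoConditions γ ρ) {β : ℝ}
    (h0 : 0 < β) (hN : Tendsto (fun n => N n / ρ n ^ β) atTop (𝓝 0)) :
    Tendsto N atTop (𝓝 0) := by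
  have h := hρ.tendsto_ρ.rpow_const (p := β) (Or.inr h0.le)
  rw [Real.zero_rpow h0.ne'] at h
  have := hN.mul h
  rw [zero_mul] at this
  refine this.congr' ?_
  filter_upwards [hr.eventually_ρ_pos] with n hn
  exact div_mul_cancel₀ _ (Real.rpow_pos_of_pos hn β).ne'

lemma abs_penaltyDrift_le {y : ℝ} (hA : pA < 1) (hB : pB < 1) (hA0 : 0 < pA) (hB0 : 0 < pB)
    (h0 : 0 ≤ y) (h1 : y ≤ 1) : |penaltyDrift pA pB y| ≤ 1 := by
  unfold penaltyDrift
  have e1 : (1 - y) ^ 2 ≤ 1 := by nlinarith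
  have e2 : y ^ 2 ≤ 1 := by nlinarith
  have e3 : (1 - y) ^ 2 * (1 - pB) ≤ 1 := mul_le_one₀ e1 (by linarith) (by linarith)
  have e4 : y ^ 2 * (1 - pA) ≤ 1 := mul_le_one₀ e2 (by linarith) (by linarith)
  have e5 : 0 ≤ (1 - y) ^ 2 * (1 - pB) := mul_nonneg (sq_nonneg _) (by linarith)
  have e6 : 0 ≤ y ^ 2 * (1 - pA) := mul_nonneg (sq_nonneg _) (by linarith)
  rw [abs_le]
  constructor <;> linarith

/-- With asymptotically negligible filtered noise, a trajectory converges to one of the two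
equilibria of the limiting equation `y' = π y (1 - y)`: once away from `0` it is pushed to `1`. -/
lemma IsPath.tendsto_zero_or_one (hr : IsRate γ ρ) (hρ : RhoConditions γ ρ)
    (hB0 : 0 < pB) (hAB : pB < pA) (hA1 : pA < 1) (hx : IsPath γ ρ pA pB x D)
    (hN : IsNoiseFilter γ D N) (hN0 : Tendsto N atTop (𝓝 0)) :
    Tendsto x atTop (𝓝 0) ∨ Tendsto x atTop (𝓝 1) := by
  rw [or_iff_not_imp_left]
  intro hnot
  have hγ0 := hρ.tendsto_γ hr
  have hπ : 0 < pA - pB := by linarith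
  obtain ⟨δ, hδ, hfreq⟩ : ∃ δ : ℝ, (0 < δ ∧ δ ≤ 1 / 8) ∧ ∃ᶠ n in atTop, 2 * δ ≤ x n := by
    rw [Metric.tendsto_nhds] at hnot
    push Not at hnot
    obtain ⟨ε, hε, hf⟩ := hnot
    refine ⟨min (ε / 2) (1 / 8), ⟨lt_min (by linarith) (by norm_num), min_le_right _ _⟩,
      hf.mono fun n hn => ?_⟩
    rw [Real.dist_eq, sub_zero, abs_of_nonneg (hx.nonneg n)] at hn
    have := min_le_left (ε / 2) (1 / 8)
    linarith
  obtain ⟨hδ0, hδ8⟩ := hδ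
  set e : ℕ → ℝ := fun n => ρ (n + 1) * penaltyDrift pA pB (x n) + N n with he
  have he0 : Tendsto e atTop (𝓝 0) := by
    have h0 := (tendsto_add_atTop_iff_nat 1).2 hρ.tendsto_ρ
    have hb : Tendsto (fun n => ρ (n + 1) * penaltyDrift pA pB (x n)) atTop (𝓝 0) := by
      have h0' := h0.abs
      rw [abs_zero] at h0'
      refine squeeze_zero_norm (fun n => ?_) h0'
      rw [Real.norm_eq_abs, abs_mul]
      exact mul_le_of_le_one_right (abs_nonneg _)
        (abs_penaltyDrift_le hA1 (by linarith) (by linarith) hB0 (hx.nonneg n) (hx.le_one n))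
    simpa using hb.add hN0
  -- the denoised path `x - N` has no martingale part left
  have hY : ∀ᶠ n in atTop, x (n + 1) - N (n + 1)
      = (x n - N n) + γ (n + 1) * ((pA - pB) * (x n * (1 - x n)) + e n) := by
    filter_upwards [hN] with n hn
    rw [hx.succ n, hn, he]
    unfold drift
    ring
  have hsmall : ∀ {u : ℕ → ℝ}, Tendsto u atTop (𝓝 0) → ∀ c : ℝ, 0 < c →
      ∀ᶠ n in atTop, |u n| ≤ c := by
    intro u hu c hc
    have := hu.abs
    rw [abs_zero] at this
    exact (this.eventually (gt_mem_nhds hc)).mono fun n h => h.le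
  obtain ⟨n0, hn0⟩ := eventually_atTop.1
    (hY.and ((hsmall he0 ((pA - pB) * (δ / 8)) (by positivity)).and
      (hsmall hN0 (δ / 4) (by positivity))))
  obtain ⟨m, hm, hmδ⟩ := frequently_atTop.1 hfreq n0
  have hstay : ∀ n, m ≤ n → δ ≤ x n - N n := by
    intro n hn
    induction n, hn using Nat.le_induction with
    | base =>
      have := abs_le.1 (hn0 m hm).2.2
      linarith
    | succ k hk ih =>
      obtain ⟨f1, f2, f3⟩ := hn0 k (hm.trans hk)
      have g1 := hr.γ_pos (k + 1) (by omega)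
      have g2 := hr.γ_lt_one (k + 1) (by omega)
      obtain ⟨f2l, f2u⟩ := abs_le.1 f2
      obtain ⟨f3l, f3u⟩ := abs_le.1 f3
      have b0 := hx.nonneg k
      have b1 := hx.le_one k
      rw [f1]
      rcases le_total (x k - N k) (1 / 2) with h | h
      · have hh : δ / 8 ≤ x k * (1 - x k) := by nlinarith
        have : 0 ≤ (pA - pB) * (x k * (1 - x k)) + e k := by nlinarith
        nlinarith [mul_nonneg g1.le this]
      · have hh : 0 ≤ x k * (1 - x k) := mul_nonneg b0 (by linarith)
        have h2 : -(δ / 8) ≤ e k := by nlinarith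
        have h3 : -(δ / 8) ≤ (pA - pB) * (x k * (1 - x k)) + e k := by
          have := mul_nonneg hπ.le hh
          linarith
        nlinarith
  have hV : Tendsto (fun n => (1 - x n) + N n) atTop (𝓝 0) := by
    refine tendsto_zero_of_contracting (γ := γ) (a := fun n => (pA - pB) * x n)
      (b := fun n => (pA - pB) * x n * N n - e n) (c := (pA - pB) * (δ / 2)) (M := pA - pB)
      (hr.eventually_γ_pos.mono fun n h => h.le) hγ0 hr.sum_γ (by positivity) ?_ ?_ ?_
    · filter_upwards [eventually_ge_atTop m] with n hn
      have h1 := hstay n hn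
      have h2 := abs_le.1 (hn0 n (hm.trans hn)).2.2
      constructor
      · have : δ / 2 ≤ x n := by linarith
        gcongr
      · exact mul_le_of_le_one_right hπ.le (hx.le_one n)
    · have hN1 : Tendsto (fun n => (pA - pB) * x n * N n) atTop (𝓝 0) := by
        have h0 := (hN0.const_mul (pA - pB)).abs
        rw [mul_zero, abs_zero] at h0
        refine squeeze_zero_norm (fun n => ?_) h0
        rw [Real.norm_eq_abs, mul_assoc, abs_mul, abs_mul, abs_mul, abs_of_nonneg (hx.nonneg n)]
        gcongr
        exact mul_le_of_le_one_left (abs_nonneg _) (hx.le_one n)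
      simpa using hN1.sub he0
    · filter_upwards [hY] with n hn
      linear_combination (-1 : ℝ) * hn
  have := ((hV.sub hN0).const_sub 1)
  simpa using this

/-- One refinement step along a trajectory converging to `0`. -/
lemma IsPath.tendsto_div_rpow_of_tendsto_zero (hr : IsRate γ ρ) (hρ : RhoConditions γ ρ)
    (hAB : pB < pA) (hA1 : pA < 1) (hx : IsPath γ ρ pA pB x D)
    (hN : IsNoiseFilter γ D N) {β : ℝ} (h0 : 0 < β) (h1 : β ≤ 1)
    (hNβ : Tendsto (fun n => N n / ρ n ^ β) atTop (𝓝 0)) (hx0 : Tendsto x atTop (𝓝 0)) :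
    Tendsto (fun n => x n / ρ n ^ β) atTop (𝓝 0) ∧ β ≠ 1 := by
  have hN0 := hρ.tendsto_zero_of_div_rpow hr h0 hNβ
  have hNβ' := hρ.tendsto_div_succ hr h0.le h1 hNβ
  have hpen : Tendsto (fun n => penaltyDrift pA pB (x n)) atTop (𝓝 (1 - pB)) := by
    have := ((continuous_penaltyDrift pA pB).tendsto 0).comp hx0
    have hv : penaltyDrift pA pB 0 = 1 - pB := by
      unfold penaltyDrift
      ring
    rwa [hv] at this
  have ha : Tendsto (fun n => (pA - pB) * (1 - x n)) atTop (𝓝 (pA - pB)) := by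
    have := (hx0.const_sub 1).const_mul (pA - pB)
    simpa using this
  have hs : Tendsto (fun n => ((pA - pB) * (1 - x n) * N n + N n
      + ρ (n + 1) * penaltyDrift pA pB (x n)) / ρ (n + 1) ^ β) atTop
      (𝓝 ((if β = 1 then 1 else 0) * (1 - pB))) := by
    have := ((ha.mul hNβ').add hNβ').add ((hρ.tendsto_div_rpow hr h1).mul hpen)
    simp only [mul_zero, zero_add] at this
    refine this.congr fun n => ?_
    ring
  obtain ⟨hw, hb⟩ := tendsto_zero_of_unstable hr hρ h0.le h1 (Y := fun n => x n - N n)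
    (by linarith) (mul_nonneg (by split_ifs <;> norm_num) (by linarith)) ha hs (by
      filter_upwards [hN] with n hn
      rw [hx.succ n, hn]
      unfold drift
      ring) (by
      intro ε hε
      filter_upwards [hNβ.eventually (gt_mem_nhds hε), hr.eventually_ρ_pos] with n hn hρn
      have := div_nonneg (hx.nonneg n) (Real.rpow_pos_of_pos hρn β).le
      rw [sub_div]
      linarith) (by simpa using hx0.sub hN0)
  constructor
  · have := hw.add hNβ
    rw [add_zero] at this
    refine this.congr fun n => ?_
    ring
  · rintro rfl
    simp only [if_true, one_mul] at hb
    linarith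

/-- One refinement step along a trajectory converging to `1`. -/
lemma IsPath.tendsto_div_rpow_of_tendsto_one (hr : IsRate γ ρ) (hρ : RhoConditions γ ρ)
    (hAB : pB < pA) (hx : IsPath γ ρ pA pB x D)
    (hN : IsNoiseFilter γ D N) {β : ℝ} (h0 : 0 < β) (h1 : β ≤ 1)
    (hNβ : Tendsto (fun n => N n / ρ n ^ β) atTop (𝓝 0)) (hx1 : Tendsto x atTop (𝓝 1)) :
    Tendsto (fun n => (1 - x n) / ρ n ^ β) atTop
      (𝓝 ((if β = 1 then 1 else 0) * (1 - pA) / (pA - pB))) := by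
  have hNβ' := hρ.tendsto_div_succ hr h0.le h1 hNβ
  have hpen : Tendsto (fun n => penaltyDrift pA pB (x n)) atTop (𝓝 (-(1 - pA))) := by
    have := ((continuous_penaltyDrift pA pB).tendsto 1).comp hx1
    have hv : penaltyDrift pA pB 1 = -(1 - pA) := by
      unfold penaltyDrift
      ring
    rwa [hv] at this
  have ha : Tendsto (fun n => -((pA - pB) * x n)) atTop (𝓝 (-(pA - pB))) := by
    have := (hx1.const_mul (pA - pB)).neg
    simpa using this
  obtain ⟨a', ha', hw⟩ := exists_normalized_recursion hr hρ h0.le h1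
    (Y := fun n => (1 - x n) + N n) (a := fun n => -((pA - pB) * x n))
    (s := fun n => -(-((pA - pB) * x n) * N n) - N n - ρ (n + 1) * penaltyDrift pA pB (x n))
    ha (by
      filter_upwards [hN] with n hn
      rw [hx.succ n, hn]
      unfold drift
      ring)
  have hlim := tendsto_of_stable_recursion (w := fun n => ((1 - x n) + N n) / ρ n ^ β)
    (b := fun n => (-(-((pA - pB) * x n) * N n) - N n - ρ (n + 1) * penaltyDrift pA pB (x n))
      / ρ (n + 1) ^ β)
    (b₀ := (if β = 1 then 1 else 0) * (1 - pA)) (hr.eventually_γ_pos.mono fun n h => h.le)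
    (hρ.tendsto_γ hr) hr.sum_γ (by linarith) ha' (by
      have := ((ha.mul hNβ').neg.sub hNβ').sub ((hρ.tendsto_div_rpow hr h1).mul hpen)
      simp only [mul_zero, neg_zero, zero_sub, mul_neg, neg_neg] at this
      refine this.congr fun n => ?_
      ring) hw
  rw [neg_div_neg_eq] at hlim
  have := hlim.sub hNβ
  rw [sub_zero] at this
  refine this.congr fun n => ?_
  ring

/-- Deterministic core of the convergence theorem. If filtering the part of the noise met while
`x n * (1 - x n) ≤ ρ n ^ (k / m)` leaves `o(ρ n ^ ((k + 1) / m))`, then each step of the bootstrap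
gains a factor `ρ n ^ (1 / m)` in the distance to the limiting equilibrium. The equilibrium `0` is
excluded when the scale `ρ n` of the penalty is reached. -/
theorem IsPath.tendsto (hr : IsRate γ ρ) (hρ : RhoConditions γ ρ)
    (hB0 : 0 < pB) (hAB : pB < pA) (hA1 : pA < 1) (hx : IsPath γ ρ pA pB x D) {m : ℕ} (hm : 0 < m)
    (hnoise : ∀ k < m, ∃ N : ℕ → ℝ,
      (∀ᶠ n in atTop, N (n + 1) = (1 - γ (n + 1)) * N n
        + γ (n + 1) * if x n * (1 - x n) ≤ ρ n ^ ((k : ℝ) / m) then D (n + 1) else 0) ∧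
      Tendsto (fun n => N n / ρ n ^ (((k + 1 : ℕ) : ℝ) / m)) atTop (𝓝 0)) :
    Tendsto (fun n => (1 - x n) / ρ n) atTop (𝓝 ((1 - pA) / (pA - pB))) := by
  have hm' : (0 : ℝ) < m := by exact_mod_cast hm
  have hfilter : ∀ k < m, (∀ᶠ n in atTop, x n * (1 - x n) ≤ ρ n ^ ((k : ℝ) / m)) →
      ∃ N, IsNoiseFilter γ D N ∧
        Tendsto (fun n => N n / ρ n ^ (((k + 1 : ℕ) : ℝ) / m)) atTop (𝓝 0) := by
    intro k hk hle
    obtain ⟨N, h1, h2⟩ := hnoise k hk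
    refine ⟨N, ?_, h2⟩
    filter_upwards [h1, hle] with n hn hn'
    rw [hn, if_pos hn']
  have hzero : ∀ᶠ n in atTop, x n * (1 - x n) ≤ ρ n ^ (((0 : ℕ) : ℝ) / m) := by
    refine Eventually.of_forall fun n => ?_
    simp only [Nat.cast_zero, zero_div, Real.rpow_zero]
    nlinarith [hx.nonneg n, hx.le_one n]
  have hβ0 : ∀ k : ℕ, 0 < ((k + 1 : ℕ) : ℝ) / m := fun k => by positivity
  have hβ1 : ∀ k < m, ((k + 1 : ℕ) : ℝ) / m ≤ 1 := fun k hk => by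
    rw [div_le_one hm']
    exact_mod_cast hk
  have hlast : ((m - 1 + 1 : ℕ) : ℝ) / m = 1 := by
    rw [Nat.sub_add_cancel hm, div_self hm'.ne']
  have hdich : Tendsto x atTop (𝓝 0) ∨ Tendsto x atTop (𝓝 1) := by
    obtain ⟨N, h1, h2⟩ := hfilter 0 hm hzero
    exact hx.tendsto_zero_or_one hr hρ hB0 hAB hA1 h1
      (hρ.tendsto_zero_of_div_rpow hr (hβ0 0) h2)
  have hle_of : ∀ {u : ℕ → ℝ} {β : ℝ}, (∀ n, x n * (1 - x n) ≤ u n) →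
      Tendsto (fun n => u n / ρ n ^ β) atTop (𝓝 0) →
      ∀ᶠ n in atTop, x n * (1 - x n) ≤ ρ n ^ β := by
    intro u β hu hlim
    filter_upwards [hlim.eventually (gt_mem_nhds one_pos), hr.eventually_ρ_pos] with n hn hn'
    rw [div_lt_one (Real.rpow_pos_of_pos hn' β)] at hn
    exact (hu n).trans hn.le
  rcases hdich with hx0 | hx1
  · exfalso
    have hall : ∀ k < m, ∀ᶠ n in atTop, x n * (1 - x n) ≤ ρ n ^ ((k : ℝ) / m) := by
      intro k
      induction k with
      | zero => exact fun _ => hzero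
      | succ k ih =>
        intro hk
        obtain ⟨N, h1, h2⟩ := hfilter k (by omega) (ih (by omega))
        exact hle_of (fun n => mul_le_of_le_one_right (hx.nonneg n) (by linarith [hx.nonneg n]))
          (hx.tendsto_div_rpow_of_tendsto_zero hr hρ hAB hA1 h1 (hβ0 k) (hβ1 k (by omega)) h2 hx0).1
    obtain ⟨N, h1, h2⟩ := hfilter (m - 1) (by omega) (hall _ (by omega))
    exact (hx.tendsto_div_rpow_of_tendsto_zero hr hρ hAB hA1 h1 (hβ0 _) (hβ1 _ (by omega)) h2
      hx0).2 hlast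
  · have hall : ∀ k < m, ∀ᶠ n in atTop, x n * (1 - x n) ≤ ρ n ^ ((k : ℝ) / m) := by
      intro k
      induction k with
      | zero => exact fun _ => hzero
      | succ k ih =>
        intro hk
        obtain ⟨N, h1, h2⟩ := hfilter k (by omega) (ih (by omega))
        have hlim := hx.tendsto_div_rpow_of_tendsto_one hr hρ hAB h1 (hβ0 k) (hβ1 k (by omega)) h2
          hx1
        have hne : ((k + 1 : ℕ) : ℝ) / m ≠ 1 := by
          rw [Ne, div_eq_one_iff_eq hm'.ne']
          exact_mod_cast hk.ne
        rw [if_neg hne, zero_mul, zero_div] at hlim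
        exact hle_of (fun n => mul_le_of_le_one_left (by linarith [hx.le_one n]) (hx.le_one n)) hlim
    obtain ⟨N, h1, h2⟩ := hfilter (m - 1) (by omega) (hall _ (by omega))
    have hlim := hx.tendsto_div_rpow_of_tendsto_one hr hρ hAB h1 (hβ0 _) (hβ1 _ (by omega)) h2 hx1
    rw [hlast] at hlim
    simpa using hlim

end Path

/-! ### Independence of the past and the next round -/

section Independence

lemma comap_prodMk_eq_generateFrom {Ω α β : Type*} [MeasurableSpace α] [MeasurableSpace β]
    (f : Ω → α) (g : Ω → β) :
    MeasurableSpace.comap (fun ω => (f ω, g ω)) inferInstance = MeasurableSpace.generateFrom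
      (Set.preimage (fun ω => (f ω, g ω)) ''
        Set.image2 (· ×ˢ ·) {s : Set α | MeasurableSet s} {t : Set β | MeasurableSet t}) := by
  rw [← MeasurableSpace.comap_generateFrom, generateFrom_prod]

/-- Two independent pairs with independent entries can be regrouped entrywise. -/
lemma indepFun_prodMk_regroup {Ω α₁ α₂ β₁ β₂ : Type*} [MeasurableSpace Ω] {μ : Measure Ω}
    [MeasurableSpace α₁] [MeasurableSpace α₂]
    [MeasurableSpace β₁] [MeasurableSpace β₂] [IsProbabilityMeasure μ] {f₁ : Ω → α₁} {f₂ : Ω → α₂}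
    {g₁ : Ω → β₁} {g₂ : Ω → β₂} (hf₁ : Measurable f₁) (hf₂ : Measurable f₂) (hg₁ : Measurable g₁)
    (hg₂ : Measurable g₂) (h : IndepFun (fun ω => (f₁ ω, f₂ ω)) (fun ω => (g₁ ω, g₂ ω)) μ)
    (hf : IndepFun f₁ f₂ μ) (hg : IndepFun g₁ g₂ μ) :
    IndepFun (fun ω => (f₁ ω, g₁ ω)) (fun ω => (f₂ ω, g₂ ω)) μ := by
  rw [IndepFun_iff_Indep, comap_prodMk_eq_generateFrom, comap_prodMk_eq_generateFrom]
  refine IndepSets.indep' ?_ ?_ (isPiSystem_prod.comap _) (isPiSystem_prod.comap _) ?_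
  · rintro _ ⟨_, ⟨s, hs, t, ht, rfl⟩, rfl⟩
    exact (hf₁.prodMk hg₁) (MeasurableSet.prod hs ht)
  · rintro _ ⟨_, ⟨s, hs, t, ht, rfl⟩, rfl⟩
    exact (hf₂.prodMk hg₂) (MeasurableSet.prod hs ht)
  · rw [IndepSets_iff]
    rintro _ _ ⟨_, ⟨a, ha, c, hc, rfl⟩, rfl⟩ ⟨_, ⟨b, hb, d, hd, rfl⟩, rfl⟩
    have e1 := h.measure_inter_preimage_eq_mul (a ×ˢ b) (c ×ˢ d) (ha.prod hb) (hc.prod hd)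
    have e2 := hf.measure_inter_preimage_eq_mul a b ha hb
    have e3 := hg.measure_inter_preimage_eq_mul c d hc hd
    have e4 := (h.comp measurable_fst measurable_fst).measure_inter_preimage_eq_mul a c ha hc
    have e5 := (h.comp measurable_snd measurable_snd).measure_inter_preimage_eq_mul b d hb hd
    have i1 : (fun ω => (f₁ ω, f₂ ω)) ⁻¹' a ×ˢ b = f₁ ⁻¹' a ∩ f₂ ⁻¹' b := rfl
    have i2 : (fun ω => (g₁ ω, g₂ ω)) ⁻¹' c ×ˢ d = g₁ ⁻¹' c ∩ g₂ ⁻¹' d := rfl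
    have i3 : (fun ω => (f₁ ω, g₁ ω)) ⁻¹' a ×ˢ c = f₁ ⁻¹' a ∩ g₁ ⁻¹' c := rfl
    have i4 : (fun ω => (f₂ ω, g₂ ω)) ⁻¹' b ×ˢ d = f₂ ⁻¹' b ∩ g₂ ⁻¹' d := rfl
    simp only [Function.comp_def] at e4 e5
    rw [i1, i2, e2, e3] at e1
    rw [i3, i4, e4, e5, Set.inter_inter_inter_comm, e1]
    ring

end Independence

lemma integrable_of_bounded {Ω : Type*} [MeasurableSpace Ω] {μ : Measure Ω} [IsFiniteMeasure μ]
    {f : Ω → ℝ} (hf : Measurable f) {C : ℝ} (hC : ∀ ω, |f ω| ≤ C) : Integrable f μ :=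
  Integrable.of_bound hf.aestronglyMeasurable C (Eventually.of_forall hC)

section Past

variable {Ω : Type*}

/-- The selection variables and the performances up to time `n`. -/
noncomputable def past (U : ℕ → Ω → ℝ) (A B : ℕ → Set Ω) (n : ℕ) (ω : Ω) :
    (Fin n → ℝ) × (Fin n → ℝ × ℝ) :=
  (fun k => U (k + 1) ω, fun k => (ind (A (k + 1)) ω, ind (B (k + 1)) ω))

/-- The information available at time `n`. -/
@[reducible] noncomputable def pastSigma (U : ℕ → Ω → ℝ) (A B : ℕ → Set Ω) (n : ℕ) :
    MeasurableSpace Ω :=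
  MeasurableSpace.comap (past U A B n) inferInstance

/-- The event `E` can serve as an outcome at time `n + 1`: it is independent of the performances up
to time `n`, and jointly with them it is independent of all selection variables. -/
structure IsFresh [MeasurableSpace Ω] (μ : Measure Ω) (U : ℕ → Ω → ℝ) (A B : ℕ → Set Ω) (n : ℕ)
    (E : Set Ω) : Prop where
  measurableSet : MeasurableSet E
  indep_U : IndepFun (fun ω (k : ℕ) => U (k + 1) ω)
    (fun ω => ((past U A B n ω).2, ind E ω)) μ
  indep_past : IndepFun (fun ω => (past U A B n ω).2) (ind E) μ

variable {U : ℕ → Ω → ℝ} {A B : ℕ → Set Ω} {n : ℕ}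

lemma ind_nonneg (E : Set Ω) (ω : Ω) : 0 ≤ ind E ω :=
  Set.indicator_nonneg (fun _ _ => zero_le_one) ω

lemma ind_le_one (E : Set Ω) (ω : Ω) : ind E ω ≤ 1 :=
  Set.indicator_le_self' (fun _ _ => zero_le_one) ω

lemma ind_of_mem {E : Set Ω} {ω : Ω} (h : ω ∈ E) : ind E ω = 1 := by simp [ind, h]

lemma ind_of_notMem {E : Set Ω} {ω : Ω} (h : ω ∉ E) : ind E ω = 0 := by simp [ind, h]

lemma ind_inter (E F : Set Ω) (ω : Ω) : ind (E ∩ F) ω = ind E ω * ind F ω := by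
  by_cases h : ω ∈ E <;> by_cases h' : ω ∈ F <;> simp [ind, h, h']

lemma ind_compl (E : Set Ω) (ω : Ω) : ind Eᶜ ω = 1 - ind E ω := by
  by_cases h : ω ∈ E
  · rw [ind_of_mem h, ind_of_notMem (by simpa using h)]; ring
  · rw [ind_of_notMem h, ind_of_mem h]; ring

lemma measurable_ind {_ : MeasurableSpace Ω} {E : Set Ω} (hE : MeasurableSet E) :
    Measurable (ind E) :=
  measurable_one.indicator hE

lemma pastSigma_mono (U : ℕ → Ω → ℝ) (A B : ℕ → Set Ω) {m n : ℕ} (hmn : m ≤ n) :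
    pastSigma U A B m ≤ pastSigma U A B n := by
  have e : past U A B m = (fun v : (Fin n → ℝ) × (Fin n → ℝ × ℝ) =>
      ((fun k : Fin m => v.1 (Fin.castLE hmn k)), (fun k : Fin m => v.2 (Fin.castLE hmn k))))
      ∘ past U A B n := rfl
  unfold pastSigma
  rw [e, ← MeasurableSpace.comap_comp]
  refine MeasurableSpace.comap_mono (Measurable.comap_le ?_)
  fun_prop

variable [MeasurableSpace Ω] {μ : Measure Ω}

lemma integral_ind {E : Set Ω} (hE : MeasurableSet E) : ∫ ω, ind E ω ∂μ = μ.real E :=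
  integral_indicator_one hE

lemma IsFresh.compl {E : Set Ω} (h : IsFresh μ U A B n E) : IsFresh μ U A B n Eᶜ := by
  have e : ind Eᶜ = (fun t : ℝ => 1 - t) ∘ ind E := funext fun ω => ind_compl E ω
  have hm : Measurable (fun t : ℝ => 1 - t) := by fun_prop
  refine ⟨h.measurableSet.compl, ?_, ?_⟩
  · have := h.indep_U.comp measurable_id (measurable_fst.prodMk (hm.comp measurable_snd))
    rw [e]
    exact this
  · rw [e]
    exact h.indep_past.comp measurable_id hm

variable {pA pB : ℝ}

lemma IsInput.isFresh_A (h : IsInput μ U A B pA pB) (n : ℕ) : IsFresh μ U A B n (A (n + 1)) := by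
  refine ⟨h.measurableSet_A _ (by omega), ?_, (h.indep_A_past n).symm⟩
  refine h.indep_U_AB.comp (φ := id)
    (ψ := fun v : ℕ → ℝ × ℝ => ((fun k : Fin n => v k), (v n).1)) measurable_id ?_
  fun_prop

lemma IsInput.isFresh_B (h : IsInput μ U A B pA pB) (n : ℕ) : IsFresh μ U A B n (B (n + 1)) := by
  refine ⟨h.measurableSet_B _ (by omega), ?_, (h.indep_B_past n).symm⟩
  refine h.indep_U_AB.comp (φ := id)
    (ψ := fun v : ℕ → ℝ × ℝ => ((fun k : Fin n => v k), (v n).2)) measurable_id ?_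
  fun_prop

lemma IsInput.measurable_past (h : IsInput μ U A B pA pB) (n : ℕ) :
    Measurable (past U A B n) := by
  refine Measurable.prodMk (measurable_pi_lambda _ fun k => h.measurable_U _ (by omega))
    (measurable_pi_lambda _ fun k => ?_)
  exact (measurable_ind (h.measurableSet_A _ (by omega))).prodMk
    (measurable_ind (h.measurableSet_B _ (by omega)))

lemma IsInput.pastSigma_le (h : IsInput μ U A B pA pB) (n : ℕ) :
    pastSigma U A B n ≤ ‹MeasurableSpace Ω› :=
  (h.measurable_past n).comap_le

lemma IsInput.measureReal_U_le (h : IsInput μ U A B pA pB) {y : ℝ} (h0 : 0 ≤ y) (h1 : y ≤ 1) :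
    μ.real {ω | U (n + 1) ω ≤ y} = y := by
  have hU := h.uniform_U (n + 1) (by omega)
  have hm := h.measurable_U (n + 1) (by omega)
  have e : μ {ω | U (n + 1) ω ≤ y} = (μ.map (U (n + 1))) (Set.Iic y) := by
    rw [Measure.map_apply hm measurableSet_Iic]
    rfl
  have hI : Set.Iic y ∩ Set.Icc (0 : ℝ) 1 = Set.Icc 0 y := by
    ext t
    simp only [Set.mem_inter_iff, Set.mem_Iic, Set.mem_Icc]
    constructor
    · rintro ⟨a, b, c⟩; exact ⟨b, a⟩
    · rintro ⟨a, b⟩; exact ⟨b, a, b.trans h1⟩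
  rw [Measure.real, e, hU, ProbabilityTheory.cond_apply measurableSet_Icc, Set.inter_comm, hI]
  simp [h0]

variable [IsProbabilityMeasure μ]

lemma IsInput.indepFun_past_fresh (h : IsInput μ U A B pA pB) {E : Set Ω}
    (hE : IsFresh μ U A B n E) :
    IndepFun (past U A B n) (fun ω => (U (n + 1) ω, ind E ω)) μ := by
  have hm := h.measurable_past n
  refine indepFun_prodMk_regroup (f₁ := fun ω => (past U A B n ω).1)
    (g₁ := fun ω => (past U A B n ω).2) (measurable_fst.comp hm) (h.measurable_U _ (by omega))
    (measurable_snd.comp hm) (measurable_ind hE.measurableSet) ?_ ?_ hE.indep_past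
  · refine hE.indep_U.comp (φ := fun v : ℕ → ℝ => ((fun k : Fin n => v k), v n)) (ψ := id) ?_
      measurable_id
    fun_prop
  · have := h.indep_U.indepFun_finset (Finset.range n) {n} (by simp)
      (fun i => h.measurable_U _ (by omega))
    exact this.comp
      (φ := fun v : (Finset.range n → ℝ) =>
        (fun k : Fin n => v ⟨k, Finset.mem_range.2 k.2⟩))
      (ψ := fun v : (({n} : Finset ℕ) → ℝ) => v ⟨n, Finset.mem_singleton_self n⟩)
      (by fun_prop) (by fun_prop)

/-- Conditionally on the past, the selection `U (n + 1) ≤ Y` has probability `Y` and is independent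
of a fresh event `E`. -/
lemma IsInput.integral_select (h : IsInput μ U A B pA pB) {E : Set Ω}
    (hE : IsFresh μ U A B n E) {V Y : Ω → ℝ} (hV : Measurable[pastSigma U A B n] V)
    (hY : Measurable[pastSigma U A B n] Y) {C : ℝ} (hVC : ∀ ω, |V ω| ≤ C) (hY0 : ∀ ω, 0 ≤ Y ω)
    (hY1 : ∀ ω, Y ω ≤ 1) :
    ∫ ω, V ω * (ind {ω' | U (n + 1) ω' ≤ Y ω'} ω * ind E ω) ∂μ
      = μ.real E * ∫ ω, V ω * Y ω ∂μ := by
  have hm := h.measurable_past n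
  have hUm := h.measurable_U (n + 1) (by omega)
  have hEm := measurable_ind hE.measurableSet
  obtain ⟨v, hv, rfl⟩ := hV.exists_eq_measurable_comp
  obtain ⟨y, hy, rfl⟩ := hY.exists_eq_measurable_comp
  simp only [Function.comp_apply] at hVC hY0 hY1 ⊢
  have hQm : Measurable (fun ω => (U (n + 1) ω, ind E ω)) := hUm.prodMk hEm
  have hind := h.indepFun_past_fresh hE
  have hmap := (indepFun_iff_map_prod_eq_prod_map_map hm.aemeasurable hQm.aemeasurable).1 hind
  have hUE : IndepFun (U (n + 1)) (ind E) μ :=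
    hE.indep_U.comp (φ := fun v : ℕ → ℝ => v n) (ψ := Prod.snd) (by fun_prop) measurable_snd
  set F : ((Fin n → ℝ) × (Fin n → ℝ × ℝ)) × (ℝ × ℝ) → ℝ := fun p =>
    v p.1 * ((if p.2.1 ≤ y p.1 then 1 else 0) * p.2.2) with hF
  have hFm : Measurable F := by
    refine (hv.comp measurable_fst).mul (Measurable.mul (Measurable.ite ?_ measurable_const
      measurable_const) (measurable_snd.comp measurable_snd))
    exact measurableSet_le (measurable_fst.comp measurable_snd) (hy.comp measurable_fst)
  have hFint : Integrable F ((μ.map (past U A B n)).prod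
      (μ.map (fun ω => (U (n + 1) ω, ind E ω)))) := by
    rw [← hmap, integrable_map_measure hFm.aestronglyMeasurable (hm.prodMk hQm).aemeasurable]
    refine integrable_of_bounded (hFm.comp (hm.prodMk hQm)) (C := C) fun ω => ?_
    simp only [Function.comp_apply, hF, abs_mul]
    have h1 : |(if U (n + 1) ω ≤ y (past U A B n ω) then (1 : ℝ) else 0)| ≤ 1 := by
      split_ifs <;> simp
    have h2 : |ind E ω| ≤ 1 := by
      rw [abs_of_nonneg (ind_nonneg _ _)]
      exact ind_le_one _ _
    calc _ ≤ |v (past U A B n ω)| * (1 * 1) := by gcongr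
      _ ≤ C := by simpa using hVC ω
  have hif : ∀ ω, ind {ω' | U (n + 1) ω' ≤ y (past U A B n ω')} ω
      = if U (n + 1) ω ≤ y (past U A B n ω) then 1 else 0 := fun ω => by
    split_ifs with hc
    · exact ind_of_mem hc
    · exact ind_of_notMem hc
  calc ∫ ω, v (past U A B n ω) * (ind {ω' | U (n + 1) ω' ≤ y (past U A B n ω')} ω * ind E ω) ∂μ
      = ∫ ω, F (past U A B n ω, (U (n + 1) ω, ind E ω)) ∂μ := by simp only [hif, hF]
    _ = ∫ p, F p ∂(μ.map (fun ω => (past U A B n ω, (U (n + 1) ω, ind E ω)))) := by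
        rw [integral_map (hm.prodMk hQm).aemeasurable hFm.aestronglyMeasurable]
    _ = ∫ p, ∫ q, F (p, q) ∂(μ.map (fun ω => (U (n + 1) ω, ind E ω))) ∂(μ.map (past U A B n)) := by
        rw [hmap, integral_prod _ hFint]
    _ = ∫ ω, ∫ q, F (past U A B n ω, q) ∂(μ.map (fun ω => (U (n + 1) ω, ind E ω))) ∂μ := by
        rw [integral_map hm.aemeasurable
          (hFm.stronglyMeasurable.integral_prod_right').aestronglyMeasurable]
    _ = ∫ ω, μ.real E * (v (past U A B n ω) * y (past U A B n ω)) ∂μ := by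
        refine integral_congr_ae (Eventually.of_forall fun ω => ?_)
        simp only
        set p := past U A B n ω with hp
        have hFp : AEStronglyMeasurable (fun q => F (p, q))
            (μ.map (fun ω => (U (n + 1) ω, ind E ω))) :=
          (hFm.comp measurable_prodMk_left).aestronglyMeasurable
        rw [integral_map hQm.aemeasurable hFp]
        have hS : MeasurableSet {ω' | U (n + 1) ω' ≤ y p} := hUm measurableSet_Iic
        have e1 : ∀ ω', F (p, (U (n + 1) ω', ind E ω'))
            = v p * (ind {ω' | U (n + 1) ω' ≤ y p} ω' * ind E ω') := fun ω' => by
          simp only [hF]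
          congr 2
        simp only [e1]
        rw [integral_const_mul]
        have hI : IndepFun (ind {ω' | U (n + 1) ω' ≤ y p}) (ind E) μ :=
          hUE.comp (φ := (Set.Iic (y p)).indicator 1) (ψ := id)
            (measurable_one.indicator measurableSet_Iic) measurable_id
        have e2 := hI.integral_fun_mul_eq_mul_integral (measurable_ind hS).aestronglyMeasurable
          hEm.aestronglyMeasurable
        rw [e2, integral_ind hS, integral_ind hE.measurableSet,
          h.measureReal_U_le (hY0 ω) (hY1 ω)]
        ring
    _ = μ.real E * ∫ ω, v (past U A B n ω) * y (past U A B n ω) ∂μ := integral_const_mul _ _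

lemma IsInput.integral_reject (h : IsInput μ U A B pA pB) {E : Set Ω}
    (hE : IsFresh μ U A B n E) {V Y : Ω → ℝ} (hV : Measurable[pastSigma U A B n] V)
    (hY : Measurable[pastSigma U A B n] Y) {C : ℝ} (hVC : ∀ ω, |V ω| ≤ C) (hY0 : ∀ ω, 0 ≤ Y ω)
    (hY1 : ∀ ω, Y ω ≤ 1) :
    ∫ ω, V ω * (ind {ω' | Y ω' < U (n + 1) ω'} ω * ind E ω) ∂μ
      = μ.real E * ∫ ω, V ω * (1 - Y ω) ∂μ := by
  have hle := h.pastSigma_le n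
  have hVm : Measurable V := hV.mono hle le_rfl
  have hYm : Measurable Y := hY.mono hle le_rfl
  have hEm := measurable_ind hE.measurableSet
  have hS : MeasurableSet {ω' | U (n + 1) ω' ≤ Y ω'} :=
    measurableSet_le (h.measurable_U _ (by omega)) hYm
  have e : ∀ ω, V ω * (ind {ω' | Y ω' < U (n + 1) ω'} ω * ind E ω)
      = V ω * ind E ω - V ω * (ind {ω' | U (n + 1) ω' ≤ Y ω'} ω * ind E ω) := fun ω => by
    have : {ω' | Y ω' < U (n + 1) ω'} = {ω' | U (n + 1) ω' ≤ Y ω'}ᶜ := by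
      ext; simp
    rw [this, ind_compl]
    ring
  have hV1 : ∫ ω, V ω * ind E ω ∂μ = μ.real E * ∫ ω, V ω ∂μ := by
    obtain ⟨v, hv, hvV⟩ := hV.exists_eq_measurable_comp
    have hI : IndepFun V (ind E) μ := by
      rw [hvV]
      exact (h.indepFun_past_fresh hE).comp hv measurable_snd
    rw [hI.integral_fun_mul_eq_mul_integral hVm.aestronglyMeasurable hEm.aestronglyMeasurable,
      integral_ind hE.measurableSet, mul_comm]
  have hb : ∀ ω, ∀ t : ℝ, |t| ≤ 1 → |V ω * t| ≤ C := fun ω t ht => by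
    rw [abs_mul]
    exact (mul_le_of_le_one_right (abs_nonneg _) ht).trans (hVC ω)
  have hb1 : ∀ (S : Set Ω) ω, |ind S ω| ≤ 1 := fun S ω => by
    rw [abs_of_nonneg (ind_nonneg _ _)]
    exact ind_le_one _ _
  simp only [e, mul_sub, mul_one]
  rw [integral_sub, integral_sub, h.integral_select hE hV hY hVC hY0 hY1, hV1]
  · ring
  · exact integrable_of_bounded hVm hVC
  · refine integrable_of_bounded (hVm.mul hYm) (C := C) fun ω => hb ω _ ?_
    rw [abs_of_nonneg (hY0 ω)]
    exact hY1 ω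
  · exact integrable_of_bounded (hVm.mul hEm) (C := C) fun ω => hb ω _ (hb1 E ω)
  · refine integrable_of_bounded (hVm.mul ((measurable_ind hS).mul hEm)) (C := C)
      fun ω => hb ω _ ?_
    rw [abs_mul]
    exact mul_le_one₀ (hb1 _ _) (abs_nonneg _) (hb1 _ _)

end Past

/-! ### Exponential moments of one round -/

section ExpStep

variable {Ω : Type*}

/-- The outcome of round `n + 1` when the four possible outcomes (selection of the first or the
second arm, success or failure) are worth `v₁`, `v₂`, `v₃`, `v₄`. -/
noncomputable def outcome (U : ℕ → Ω → ℝ) (A B : ℕ → Set Ω) (n : ℕ) (Y v₁ v₂ v₃ v₄ : Ω → ℝ)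
    (ω : Ω) : ℝ :=
  v₁ ω * (ind {ω' | U (n + 1) ω' ≤ Y ω'} ω * ind (A (n + 1)) ω)
    + v₂ ω * (ind {ω' | U (n + 1) ω' ≤ Y ω'} ω * ind (A (n + 1))ᶜ ω)
    + v₃ ω * (ind {ω' | Y ω' < U (n + 1) ω'} ω * ind (B (n + 1)) ω)
    + v₄ ω * (ind {ω' | Y ω' < U (n + 1) ω'} ω * ind (B (n + 1))ᶜ ω)

/-- Exactly one of the four outcomes occurs. -/
lemma outcome_cases (U : ℕ → Ω → ℝ) (A B : ℕ → Set Ω) (n : ℕ) (Y : Ω → ℝ) (ω : Ω) :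
    (∀ v₁ v₂ v₃ v₄ : Ω → ℝ, outcome U A B n Y v₁ v₂ v₃ v₄ ω = v₁ ω) ∨
    (∀ v₁ v₂ v₃ v₄ : Ω → ℝ, outcome U A B n Y v₁ v₂ v₃ v₄ ω = v₂ ω) ∨
    (∀ v₁ v₂ v₃ v₄ : Ω → ℝ, outcome U A B n Y v₁ v₂ v₃ v₄ ω = v₃ ω) ∨
    (∀ v₁ v₂ v₃ v₄ : Ω → ℝ, outcome U A B n Y v₁ v₂ v₃ v₄ ω = v₄ ω) := by
  unfold outcome
  by_cases hU : U (n + 1) ω ≤ Y ω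
  · have h1 : ind {ω' | U (n + 1) ω' ≤ Y ω'} ω = 1 := ind_of_mem hU
    have h2 : ind {ω' | Y ω' < U (n + 1) ω'} ω = 0 := ind_of_notMem (not_lt.2 hU)
    by_cases hA : ω ∈ A (n + 1)
    · left
      simp [h1, h2, ind_compl, ind_of_mem hA]
    · right; left
      simp [h1, h2, ind_compl, ind_of_notMem hA]
  · have h1 : ind {ω' | U (n + 1) ω' ≤ Y ω'} ω = 0 := ind_of_notMem hU
    have h2 : ind {ω' | Y ω' < U (n + 1) ω'} ω = 1 := ind_of_mem (not_le.1 hU)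
    by_cases hB : ω ∈ B (n + 1)
    · right; right; left
      simp [h1, h2, ind_compl, ind_of_mem hB]
    · right; right; right
      simp [h1, h2, ind_compl, ind_of_notMem hB]

variable [MeasurableSpace Ω] {μ : Measure Ω} {U : ℕ → Ω → ℝ} {A B : ℕ → Set Ω} {pA pB : ℝ}

lemma integral_add_four {f g u v : Ω → ℝ} (hf : Integrable f μ) (hg : Integrable g μ)
    (hu : Integrable u μ) (hv : Integrable v μ) :
    ∫ ω, (f ω + g ω + u ω + v ω) ∂μ
      = ∫ ω, f ω ∂μ + ∫ ω, g ω ∂μ + ∫ ω, u ω ∂μ + ∫ ω, v ω ∂μ := by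
  have e1 := integral_add ((hf.add hg).add hu) hv
  have e2 := integral_add (hf.add hg) hu
  simp only [Pi.add_apply] at e1 e2
  rw [e1, e2, integral_add hf hg]

variable [IsProbabilityMeasure μ]

/-- Conditional exponential moment bound for one round: if the outcome is at most `1` in absolute
value, conditionally centered, with conditional variance at most `q`, then its exponential has
conditional mean at most `exp q`. -/
lemma IsInput.integral_mul_exp_outcome_le (h : IsInput μ U A B pA pB) {n : ℕ}
    {V Y v₁ v₂ v₃ v₄ : Ω → ℝ} (hV : Measurable[pastSigma U A B n] V)
    (hY : Measurable[pastSigma U A B n] Y) (h₁ : Measurable[pastSigma U A B n] v₁)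
    (h₂ : Measurable[pastSigma U A B n] v₂) (h₃ : Measurable[pastSigma U A B n] v₃)
    (h₄ : Measurable[pastSigma U A B n] v₄) {C q : ℝ} (hV0 : ∀ ω, 0 ≤ V ω) (hVC : ∀ ω, V ω ≤ C)
    (hY0 : ∀ ω, 0 ≤ Y ω) (hY1 : ∀ ω, Y ω ≤ 1) (hb₁ : ∀ ω, |v₁ ω| ≤ 1) (hb₂ : ∀ ω, |v₂ ω| ≤ 1)
    (hb₃ : ∀ ω, |v₃ ω| ≤ 1) (hb₄ : ∀ ω, |v₄ ω| ≤ 1)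
    (hmean : ∀ ω, Y ω * (pA * v₁ ω + (1 - pA) * v₂ ω)
      + (1 - Y ω) * (pB * v₃ ω + (1 - pB) * v₄ ω) = 0)
    (hvar : ∀ ω, Y ω * (pA * v₁ ω ^ 2 + (1 - pA) * v₂ ω ^ 2)
      + (1 - Y ω) * (pB * v₃ ω ^ 2 + (1 - pB) * v₄ ω ^ 2) ≤ q) :
    ∫ ω, V ω * Real.exp (outcome U A B n Y v₁ v₂ v₃ v₄ ω) ∂μ ≤ Real.exp q * ∫ ω, V ω ∂μ := by
  have hle := h.pastSigma_le n
  have hC : ∀ ω, |V ω| ≤ C := fun ω => by rw [abs_of_nonneg (hV0 ω)]; exact hVC ω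
  have hVm : Measurable V := hV.mono hle le_rfl
  have hYm : Measurable Y := hY.mono hle le_rfl
  have hS : MeasurableSet {ω' | U (n + 1) ω' ≤ Y ω'} :=
    measurableSet_le (h.measurable_U _ (by omega)) hYm
  have hS' : MeasurableSet {ω' | Y ω' < U (n + 1) ω'} :=
    measurableSet_lt hYm (h.measurable_U _ (by omega))
  have hAm := h.measurableSet_A (n + 1) (by omega)
  have hBm := h.measurableSet_B (n + 1) (by omega)
  -- the quadratic majorant of the exponential, weighted by `V`
  set W : (Ω → ℝ) → Ω → ℝ := fun v ω => V ω * (1 + v ω + v ω ^ 2) with hW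
  have hWm : ∀ v : Ω → ℝ, Measurable[pastSigma U A B n] v → Measurable[pastSigma U A B n] (W v) :=
    fun v hv => hV.mul ((measurable_const.add hv).add (hv.pow_const 2))
  have hWb : ∀ v : Ω → ℝ, (∀ ω, |v ω| ≤ 1) → ∀ ω, |W v ω| ≤ C * 3 := fun v hv ω => by
    have h1 := abs_le.1 (hv ω)
    have h2 : |1 + v ω + v ω ^ 2| ≤ 3 := by
      rw [abs_le]
      constructor <;> nlinarith
    rw [hW]
    simp only [abs_mul]
    exact mul_le_mul (hC ω) h2 (abs_nonneg _) ((abs_nonneg _).trans (hC ω))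
  have hWI : ∀ (v : Ω → ℝ) (S E : Set Ω), Measurable[pastSigma U A B n] v → (∀ ω, |v ω| ≤ 1) →
      MeasurableSet S → MeasurableSet E → Integrable (fun ω => W v ω * (ind S ω * ind E ω)) μ := by
    intro v S E hv hvb hSm hEm
    refine integrable_of_bounded (((hWm v hv).mono hle le_rfl).mul
      ((measurable_ind hSm).mul (measurable_ind hEm))) (C := C * 3) fun ω => ?_
    rw [abs_mul, abs_of_nonneg (mul_nonneg (ind_nonneg S ω) (ind_nonneg E ω))]
    exact (mul_le_of_le_one_right (abs_nonneg _)
      (mul_le_one₀ (ind_le_one _ _) (ind_nonneg _ _) (ind_le_one _ _))).trans (hWb v hvb ω)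
  have hWY : ∀ (v Z : Ω → ℝ), Measurable[pastSigma U A B n] v → (∀ ω, |v ω| ≤ 1) →
      Measurable Z → (∀ ω, 0 ≤ Z ω) → (∀ ω, Z ω ≤ 1) → Integrable (fun ω => W v ω * Z ω) μ := by
    intro v Z hv hvb hZm hZ0 hZ1
    refine integrable_of_bounded (((hWm v hv).mono hle le_rfl).mul hZm) (C := C * 3) fun ω => ?_
    rw [abs_mul, abs_of_nonneg (hZ0 ω)]
    exact (mul_le_of_le_one_right (abs_nonneg _) (hZ1 ω)).trans (hWb v hvb ω)
  have i₁ := hWI v₁ _ _ h₁ hb₁ hS hAm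
  have i₂ := hWI v₂ _ _ h₂ hb₂ hS hAm.compl
  have i₃ := hWI v₃ _ _ h₃ hb₃ hS' hBm
  have i₄ := hWI v₄ _ _ h₄ hb₄ hS' hBm.compl
  have hY1m : Measurable (fun ω => 1 - Y ω) := measurable_const.sub hYm
  have j₁ := hWY v₁ Y h₁ hb₁ hYm hY0 hY1
  have j₂ := hWY v₂ Y h₂ hb₂ hYm hY0 hY1
  have j₃ := hWY v₃ (fun ω => 1 - Y ω) h₃ hb₃ hY1m (fun ω => by linarith [hY1 ω])
    (fun ω => by linarith [hY0 ω])
  have j₄ := hWY v₄ (fun ω => 1 - Y ω) h₄ hb₄ hY1m (fun ω => by linarith [hY1 ω])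
    (fun ω => by linarith [hY0 ω])
  have hq : ∀ t : ℝ, |t| ≤ 1 → Real.exp t ≤ 1 + t + t ^ 2 := fun t ht => by
    have := (abs_le.1 (Real.abs_exp_sub_one_sub_id_le ht)).2
    linarith
  have hpt : ∀ ω, V ω * Real.exp (outcome U A B n Y v₁ v₂ v₃ v₄ ω)
      ≤ outcome U A B n Y (W v₁) (W v₂) (W v₃) (W v₄) ω := by
    intro ω
    rcases outcome_cases U A B n Y ω with hc | hc | hc | hc
    · rw [hc, hc]; exact mul_le_mul_of_nonneg_left (hq _ (hb₁ ω)) (hV0 ω)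
    · rw [hc, hc]; exact mul_le_mul_of_nonneg_left (hq _ (hb₂ ω)) (hV0 ω)
    · rw [hc, hc]; exact mul_le_mul_of_nonneg_left (hq _ (hb₃ ω)) (hV0 ω)
    · rw [hc, hc]; exact mul_le_mul_of_nonneg_left (hq _ (hb₄ ω)) (hV0 ω)
  have pA' : μ.real (A (n + 1))ᶜ = 1 - pA := by
    rw [probReal_compl_eq_one_sub hAm, h.prob_A _ (by omega)]
  have pB' : μ.real (B (n + 1))ᶜ = 1 - pB := by
    rw [probReal_compl_eq_one_sub hBm, h.prob_B _ (by omega)]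
  calc ∫ ω, V ω * Real.exp (outcome U A B n Y v₁ v₂ v₃ v₄ ω) ∂μ
      ≤ ∫ ω, outcome U A B n Y (W v₁) (W v₂) (W v₃) (W v₄) ω ∂μ := by
        refine integral_mono_of_nonneg (Eventually.of_forall fun ω =>
          mul_nonneg (hV0 ω) (Real.exp_pos _).le) ?_ (Eventually.of_forall hpt)
        exact ((i₁.add i₂).add i₃).add i₄
    _ = ∫ ω, (pA * (W v₁ ω * Y ω) + (1 - pA) * (W v₂ ω * Y ω)
          + pB * (W v₃ ω * (1 - Y ω)) + (1 - pB) * (W v₄ ω * (1 - Y ω))) ∂μ := by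
        unfold outcome
        rw [integral_add_four i₁ i₂ i₃ i₄,
          integral_add_four (j₁.const_mul pA) (j₂.const_mul (1 - pA)) (j₃.const_mul pB)
            (j₄.const_mul (1 - pB)),
          h.integral_select (h.isFresh_A n) (hWm v₁ h₁) hY (hWb v₁ hb₁) hY0 hY1,
          h.integral_select (h.isFresh_A n).compl (hWm v₂ h₂) hY (hWb v₂ hb₂) hY0 hY1,
          h.integral_reject (h.isFresh_B n) (hWm v₃ h₃) hY (hWb v₃ hb₃) hY0 hY1,
          h.integral_reject (h.isFresh_B n).compl (hWm v₄ h₄) hY (hWb v₄ hb₄) hY0 hY1,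
          pA', pB', h.prob_A _ (by omega), h.prob_B _ (by omega), integral_const_mul,
          integral_const_mul, integral_const_mul, integral_const_mul]
    _ ≤ ∫ ω, Real.exp q * V ω ∂μ := by
        refine integral_mono ?_ ((integrable_of_bounded hVm hC).const_mul _) fun ω => ?_
        · exact (((j₁.const_mul pA).add (j₂.const_mul (1 - pA))).add (j₃.const_mul pB)).add
            (j₄.const_mul (1 - pB))
        · have e : pA * (W v₁ ω * Y ω) + (1 - pA) * (W v₂ ω * Y ω)
              + pB * (W v₃ ω * (1 - Y ω)) + (1 - pB) * (W v₄ ω * (1 - Y ω))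
              = V ω * (1 + (Y ω * (pA * v₁ ω + (1 - pA) * v₂ ω)
                  + (1 - Y ω) * (pB * v₃ ω + (1 - pB) * v₄ ω))
                + (Y ω * (pA * v₁ ω ^ 2 + (1 - pA) * v₂ ω ^ 2)
                  + (1 - Y ω) * (pB * v₃ ω ^ 2 + (1 - pB) * v₄ ω ^ 2))) := by
            rw [hW]
            ring
          simp only [e, hmean ω]
          rw [mul_comm (Real.exp q)]
          refine mul_le_mul_of_nonneg_left ?_ (hV0 ω)
          have := Real.add_one_le_exp q
          linarith [hvar ω]
    _ = Real.exp q * ∫ ω, V ω ∂μ := integral_const_mul _ _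

end ExpStep

/-! ### The algorithm, its noise and the filter -/

section Trajectory

variable {Ω : Type*} {γ ρ : ℕ → ℝ} {U : ℕ → Ω → ℝ} {A B : ℕ → Set Ω} {pA pB x : ℝ}

lemma X_succ (n : ℕ) (ω : Ω) : X γ ρ U A B x (n + 1) ω = X γ ρ U A B x n ω + γ (n + 1) *
    outcome U A B n (X γ ρ U A B x n) (fun ω => 1 - X γ ρ U A B x n ω)
      (fun ω => -(ρ (n + 1) * X γ ρ U A B x n ω)) (fun ω => -X γ ρ U A B x n ω)
      (fun ω => ρ (n + 1) * (1 - X γ ρ U A B x n ω)) ω := by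
  rw [X, outcome]
  simp only [ind_inter]
  ring

lemma X_mem_Icc (hr : IsRate γ ρ) (hx0 : 0 ≤ x) (hx1 : x ≤ 1) (n : ℕ) (ω : Ω) :
    0 ≤ X γ ρ U A B x n ω ∧ X γ ρ U A B x n ω ≤ 1 := by
  induction n with
  | zero => exact ⟨hx0, hx1⟩
  | succ n ih =>
    obtain ⟨i0, i1⟩ := ih
    have g0 := hr.γ_pos (n + 1) (by omega)
    have g1 := hr.γ_lt_one (n + 1) (by omega)
    have r0 := mul_pos g0 (hr.ρ_pos (n + 1) (by omega))
    have r1 := hr.γρ_lt_one (n + 1) (by omega)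
    rw [X_succ]
    rcases outcome_cases U A B n (X γ ρ U A B x n) ω with hc | hc | hc | hc <;> rw [hc] <;>
      constructor <;> nlinarith

/-- The martingale increment driving the algorithm: the normalized increment minus its drift. At
index `0` the value is irrelevant. -/
noncomputable def noise (γ ρ : ℕ → ℝ) (U : ℕ → Ω → ℝ) (A B : ℕ → Set Ω) (pA pB x : ℝ) (n : ℕ)
    (ω : Ω) : ℝ :=
  (X γ ρ U A B x n ω - X γ ρ U A B x (n - 1) ω) / γ n - drift pA pB (ρ n) (X γ ρ U A B x (n - 1) ω)

lemma isPath_X (hr : IsRate γ ρ) (hx0 : 0 ≤ x) (hx1 : x ≤ 1) (ω : Ω) :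
    IsPath γ ρ pA pB (fun n => X γ ρ U A B x n ω) (fun n => noise γ ρ U A B pA pB x n ω) where
  nonneg n := (X_mem_Icc hr hx0 hx1 n ω).1
  le_one n := (X_mem_Icc hr hx0 hx1 n ω).2
  succ n := by
    have g0 := hr.γ_pos (n + 1) (by omega)
    simp only [noise, Nat.add_sub_cancel]
    field_simp
    ring

lemma noise_succ (hr : IsRate γ ρ) (n : ℕ) (ω : Ω) :
    noise γ ρ U A B pA pB x (n + 1) ω = outcome U A B n (X γ ρ U A B x n)
      (fun ω => 1 - X γ ρ U A B x n ω - drift pA pB (ρ (n + 1)) (X γ ρ U A B x n ω))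
      (fun ω => -(ρ (n + 1) * X γ ρ U A B x n ω) - drift pA pB (ρ (n + 1)) (X γ ρ U A B x n ω))
      (fun ω => -X γ ρ U A B x n ω - drift pA pB (ρ (n + 1)) (X γ ρ U A B x n ω))
      (fun ω => ρ (n + 1) * (1 - X γ ρ U A B x n ω)
        - drift pA pB (ρ (n + 1)) (X γ ρ U A B x n ω)) ω := by
  have g0 := hr.γ_pos (n + 1) (by omega)
  rw [noise, X_succ, Nat.add_sub_cancel, add_sub_cancel_left, mul_div_cancel_left₀ _ g0.ne']
  rcases outcome_cases U A B n (X γ ρ U A B x n) ω with hc | hc | hc | hc <;> rw [hc, hc]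

/-- The discounted average of the noise, started at time `n₀`, in which only the noise met while
`x n * (1 - x n) ≤ ρ n ^ β` is taken into account. -/
noncomputable def noiseFilter (γ ρ x D : ℕ → ℝ) (β : ℝ) (n₀ : ℕ) : ℕ → ℝ
  | 0 => 0
  | n + 1 => if n < n₀ then 0 else (1 - γ (n + 1)) * noiseFilter γ ρ x D β n₀ n
      + γ (n + 1) * if x n * (1 - x n) ≤ ρ n ^ β then D (n + 1) else 0

lemma noiseFilter_of_le {y D : ℕ → ℝ} {β : ℝ} {n₀ n : ℕ} (h : n ≤ n₀) :
    noiseFilter γ ρ y D β n₀ n = 0 := by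
  cases n with
  | zero => rfl
  | succ n => rw [noiseFilter, if_pos (by omega)]

lemma noiseFilter_succ {y D : ℕ → ℝ} {β : ℝ} {n₀ n : ℕ} (h : n₀ ≤ n) :
    noiseFilter γ ρ y D β n₀ (n + 1) = (1 - γ (n + 1)) * noiseFilter γ ρ y D β n₀ n
      + γ (n + 1) * if y n * (1 - y n) ≤ ρ n ^ β then D (n + 1) else 0 := by
  rw [noiseFilter, if_neg (by omega)]

end Trajectory

section Bounds

variable {pA pB r y : ℝ}

lemma abs_mix_le {p a b : ℝ} (h0 : 0 ≤ p) (h1 : p ≤ 1) (ha : |a| ≤ 1) (hb : |b| ≤ 1) :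
    |p * a + (1 - p) * b| ≤ 1 := by
  rw [abs_le] at *
  constructor <;> nlinarith

lemma abs_drift_le (hA0 : 0 ≤ pA) (hA1 : pA ≤ 1) (hB0 : 0 ≤ pB) (hB1 : pB ≤ 1) (hr0 : 0 ≤ r)
    (hr1 : r ≤ 1) (hy0 : 0 ≤ y) (hy1 : y ≤ 1) : |drift pA pB r y| ≤ 1 := by
  have e : drift pA pB r y = y * (pA * (1 - y) + (1 - pA) * -(r * y))
      + (1 - y) * (pB * -y + (1 - pB) * (r * (1 - y))) := by
    unfold drift penaltyDrift
    ring
  rw [e]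
  refine abs_mix_le hy0 hy1 (abs_mix_le hA0 hA1 ?_ ?_) (abs_mix_le hB0 hB1 ?_ ?_) <;>
    rw [abs_le] <;> constructor <;> nlinarith

lemma mean_jump_eq_zero : y * (pA * (1 - y - drift pA pB r y)
      + (1 - pA) * (-(r * y) - drift pA pB r y))
    + (1 - y) * (pB * (-y - drift pA pB r y) + (1 - pB) * (r * (1 - y) - drift pA pB r y)) = 0 := by
  unfold drift penaltyDrift
  ring

/-- The conditional variance of the noise is small near both ends of `[0, 1]`. -/
lemma variance_jump_le (hA0 : 0 ≤ pA) (hA1 : pA ≤ 1) (hB0 : 0 ≤ pB) (hB1 : pB ≤ 1)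
    (hy0 : 0 ≤ y) (hy1 : y ≤ 1) :
    y * (pA * (1 - y - drift pA pB r y) ^ 2 + (1 - pA) * (-(r * y) - drift pA pB r y) ^ 2)
      + (1 - y) * (pB * (-y - drift pA pB r y) ^ 2
        + (1 - pB) * (r * (1 - y) - drift pA pB r y) ^ 2) ≤ y * (1 - y) + r ^ 2 := by
  have e : y * (pA * (1 - y - drift pA pB r y) ^ 2 + (1 - pA) * (-(r * y) - drift pA pB r y) ^ 2)
      + (1 - y) * (pB * (-y - drift pA pB r y) ^ 2
        + (1 - pB) * (r * (1 - y) - drift pA pB r y) ^ 2)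
      = y * (1 - y) * (pA * (1 - y) + pB * y)
        + r ^ 2 * (y * (y ^ 2 * (1 - pA)) + (1 - y) * ((1 - y) ^ 2 * (1 - pB)))
        - drift pA pB r y ^ 2 := by
    unfold drift penaltyDrift
    ring
  have hz : 0 ≤ 1 - y := by linarith
  have h1 : pA * (1 - y) + pB * y ≤ 1 := by nlinarith
  have h2 : y ^ 2 * (1 - pA) ≤ 1 := mul_le_one₀ (by nlinarith) (by linarith) (by linarith)
  have h3 : (1 - y) ^ 2 * (1 - pB) ≤ 1 := mul_le_one₀ (by nlinarith) (by linarith) (by linarith)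
  have h4 : y * (y ^ 2 * (1 - pA)) + (1 - y) * ((1 - y) ^ 2 * (1 - pB)) ≤ 1 := by nlinarith
  have h5 := mul_le_mul_of_nonneg_left h1 (mul_nonneg hy0 hz)
  have h6 := mul_le_mul_of_nonneg_left h4 (sq_nonneg r)
  rw [e]
  nlinarith [sq_nonneg (drift pA pB r y)]

end Bounds

section Filter

variable {Ω : Type*} {γ ρ : ℕ → ℝ} {U : ℕ → Ω → ℝ} {A B : ℕ → Set Ω} {pA pB x : ℝ}

lemma measurable_outcome {n : ℕ} {Y v₁ v₂ v₃ v₄ : Ω → ℝ} (hY : Measurable[pastSigma U A B n] Y)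
    (h₁ : Measurable[pastSigma U A B n] v₁) (h₂ : Measurable[pastSigma U A B n] v₂)
    (h₃ : Measurable[pastSigma U A B n] v₃) (h₄ : Measurable[pastSigma U A B n] v₄) :
    Measurable[pastSigma U A B (n + 1)] (outcome U A B n Y v₁ v₂ v₃ v₄) := by
  have hle := pastSigma_mono U A B (Nat.le_succ n)
  let _ : MeasurableSpace Ω := pastSigma U A B (n + 1)
  have hp : Measurable (past U A B (n + 1)) := comap_measurable _
  have hU : Measurable (U (n + 1)) := (measurable_pi_apply (Fin.last n)).comp
    (measurable_fst.comp hp)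
  have hAB : Measurable (fun ω => (ind (A (n + 1)) ω, ind (B (n + 1)) ω)) :=
    (measurable_pi_apply (Fin.last n)).comp (measurable_snd.comp hp)
  have hA : Measurable (ind (A (n + 1))) := measurable_fst.comp hAB
  have hB : Measurable (ind (B (n + 1))) := measurable_snd.comp hAB
  have hA' : Measurable (ind (A (n + 1))ᶜ) := by
    rw [show ind (A (n + 1))ᶜ = _ from funext (ind_compl _)]
    exact measurable_const.sub hA
  have hB' : Measurable (ind (B (n + 1))ᶜ) := by
    rw [show ind (B (n + 1))ᶜ = _ from funext (ind_compl _)]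
    exact measurable_const.sub hB
  have hY' : Measurable Y := hY.mono hle le_rfl
  have hS := measurable_ind (measurableSet_le hU hY')
  have hS' := measurable_ind (measurableSet_lt hY' hU)
  exact ((((h₁.mono hle le_rfl).mul (hS.mul hA)).add ((h₂.mono hle le_rfl).mul (hS.mul hA'))).add
    ((h₃.mono hle le_rfl).mul (hS'.mul hB))).add ((h₄.mono hle le_rfl).mul (hS'.mul hB'))

lemma measurable_X (γ ρ : ℕ → ℝ) (U : ℕ → Ω → ℝ) (A B : ℕ → Set Ω) (x : ℝ) (n : ℕ) :
    Measurable[pastSigma U A B n] (X γ ρ U A B x n) := by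
  induction n with
  | zero => exact measurable_const
  | succ n ih =>
    rw [show X γ ρ U A B x (n + 1) = _ from funext fun ω => X_succ n ω]
    refine Measurable.add (ih.mono (pastSigma_mono U A B (Nat.le_succ n)) le_rfl)
      (Measurable.const_mul (measurable_outcome ih ?_ ?_ ?_ ?_) _)
    · exact measurable_const.sub ih
    · exact (ih.const_mul _).neg
    · exact ih.neg
    · exact (measurable_const.sub ih).const_mul _

lemma measurable_drift (pA pB r : ℝ) : Measurable (drift pA pB r) := by
  unfold drift penaltyDrift
  fun_prop

/-- The filtered noise of the algorithm. -/
noncomputable def filteredNoise (γ ρ : ℕ → ℝ) (U : ℕ → Ω → ℝ) (A B : ℕ → Set Ω) (pA pB x β : ℝ)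
    (n₀ n : ℕ) (ω : Ω) : ℝ :=
  noiseFilter γ ρ (fun k => X γ ρ U A B x k ω) (fun k => noise γ ρ U A B pA pB x k ω) β n₀ n

/-- One step of the filter, with the truncated noise written as an outcome. -/
lemma filteredNoise_succ (hr : IsRate γ ρ) {β : ℝ} {n₀ n : ℕ} (hn : n₀ ≤ n) (c : ℝ) (ω : Ω) :
    c * filteredNoise γ ρ U A B pA pB x β n₀ (n + 1) ω
      = c * (1 - γ (n + 1)) * filteredNoise γ ρ U A B pA pB x β n₀ n ω
      + outcome U A B n (X γ ρ U A B x n)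
      (fun ω => (if X γ ρ U A B x n ω * (1 - X γ ρ U A B x n ω) ≤ ρ n ^ β then c * γ (n + 1) else 0)
        * (1 - X γ ρ U A B x n ω - drift pA pB (ρ (n + 1)) (X γ ρ U A B x n ω)))
      (fun ω => (if X γ ρ U A B x n ω * (1 - X γ ρ U A B x n ω) ≤ ρ n ^ β then c * γ (n + 1) else 0)
        * (-(ρ (n + 1) * X γ ρ U A B x n ω) - drift pA pB (ρ (n + 1)) (X γ ρ U A B x n ω)))
      (fun ω => (if X γ ρ U A B x n ω * (1 - X γ ρ U A B x n ω) ≤ ρ n ^ β then c * γ (n + 1) else 0)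
        * (-X γ ρ U A B x n ω - drift pA pB (ρ (n + 1)) (X γ ρ U A B x n ω)))
      (fun ω => (if X γ ρ U A B x n ω * (1 - X γ ρ U A B x n ω) ≤ ρ n ^ β then c * γ (n + 1) else 0)
        * (ρ (n + 1) * (1 - X γ ρ U A B x n ω)
          - drift pA pB (ρ (n + 1)) (X γ ρ U A B x n ω))) ω := by
  rw [filteredNoise, noiseFilter_succ hn, noise_succ hr]
  rcases outcome_cases U A B n (X γ ρ U A B x n) ω with hc | hc | hc | hc <;> rw [hc, hc] <;>
    simp only [filteredNoise] <;> split_ifs <;> ring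

lemma measurable_filteredNoise (hr : IsRate γ ρ) (β : ℝ) (n₀ n : ℕ) :
    Measurable[pastSigma U A B n] (filteredNoise γ ρ U A B pA pB x β n₀ n) := by
  induction n with
  | zero => exact measurable_const
  | succ n ih =>
    rcases lt_or_ge n n₀ with hn | hn
    · have e : filteredNoise γ ρ U A B pA pB x β n₀ (n + 1) = fun _ => 0 :=
        funext fun ω => noiseFilter_of_le (by omega)
      rw [e]
      exact measurable_const
    · have e := funext fun ω => filteredNoise_succ (pA := pA) (pB := pB) (x := x) (U := U) (A := A)
        (B := B) (β := β) hr hn 1 ω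
      simp only [one_mul] at e
      have hX := measurable_X γ ρ U A B x n
      have hd := (measurable_drift pA pB (ρ (n + 1))).comp hX
      have hc : Measurable[pastSigma U A B n] (fun ω => if X γ ρ U A B x n ω
          * (1 - X γ ρ U A B x n ω) ≤ ρ n ^ β then γ (n + 1) else 0) :=
        Measurable.ite (measurableSet_le (hX.mul (measurable_const.sub hX)) measurable_const)
          measurable_const measurable_const
      rw [show filteredNoise γ ρ U A B pA pB x β n₀ (n + 1) = _ from e]
      refine Measurable.add ((ih.mono (pastSigma_mono U A B (Nat.le_succ n)) le_rfl).const_mul _)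
        (measurable_outcome hX ?_ ?_ ?_ ?_)
      · exact hc.mul ((measurable_const.sub hX).sub hd)
      · exact hc.mul ((hX.const_mul _).neg.sub hd)
      · exact hc.mul (hX.neg.sub hd)
      · exact hc.mul (((measurable_const.sub hX).const_mul _).sub hd)

end Filter

/-! ### Concentration of the filtered noise and convergence -/

section Concentration

variable {Ω : Type*} {γ ρ : ℕ → ℝ} {U : ℕ → Ω → ℝ} {A B : ℕ → Set Ω} {pA pB x β : ℝ} {n₀ : ℕ}

/-- From the index `n₀` on, the rates are in the regime where the exponential moments of the
filtered noise can be controlled inductively. -/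
structure IsControlledFrom (γ ρ : ℕ → ℝ) (β : ℝ) (n₀ : ℕ) : Prop where
  one_le : 1 ≤ n₀
  ρ_le : ∀ n, n₀ ≤ n → ρ (n + 1) ≤ 1
  γ_le : ∀ n, n₀ ≤ n → γ n ≤ γ (n + 1) * (1 + γ (n + 1) / 2)
  γρ_le : ∀ n, n₀ ≤ n → γ n * ρ n ^ β ≤ γ (n + 1) * ρ (n + 1) ^ β * (1 + γ (n + 1) / 2)
  rpow_le : ∀ n, n₀ ≤ n → ρ n ^ β ≤ 2 * ρ (n + 1) ^ β

lemma exists_isControlledFrom (hr : IsRate γ ρ) (hρ : RhoConditions γ ρ)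
    (hreg : RegularityCondition γ ρ) (h0 : 0 ≤ β) (h1 : β ≤ 1) :
    ∃ n₀, IsControlledFrom γ ρ β n₀ := by
  have key : ∀ b ∈ Set.Icc (0 : ℝ) 1, ∀ᶠ n in atTop,
      γ n * ρ n ^ b ≤ γ (n + 1) * ρ (n + 1) ^ b * (1 + γ (n + 1) / 2) := by
    intro b hb
    have := (hreg b hb).def (show (0 : ℝ) < 1 / 2 by norm_num)
    filter_upwards [this] with n hn
    have g := hr.γ_pos (n + 1) (by omega)
    have p := Real.rpow_pos_of_pos (hr.ρ_pos (n + 1) (by omega)) b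
    rw [Real.norm_eq_abs, Real.norm_eq_abs,
      abs_of_pos (by positivity : 0 < γ (n + 1) ^ 2 * _)] at hn
    have := (abs_le.1 hn).1
    nlinarith
  have e1 := (tendsto_add_atTop_iff_nat 1).2 hρ.tendsto_ρ
  have e2 := hρ.tendsto_rpow_ratio_one hr h0 h1
  obtain ⟨n₀, h⟩ := eventually_atTop.1 ((key 0 ⟨le_rfl, zero_le_one⟩).and ((key β ⟨h0, h1⟩).and
    ((e1.eventually (gt_mem_nhds one_pos)).and ((e2.eventually (gt_mem_nhds one_lt_two)).and
      (eventually_ge_atTop 1)))))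
  refine ⟨n₀, (h n₀ le_rfl).2.2.2.2, fun n hn => (h n hn).2.2.1.le, fun n hn => ?_,
    fun n hn => (h n hn).2.1, fun n hn => ?_⟩
  · simpa using (h n hn).1
  · have h3 := (h n hn).2.2.2.1
    have a1 := hr.ρ_pos n (h n hn).2.2.2.2
    have a2 := hr.ρ_pos (n + 1) (by omega)
    rw [Real.div_rpow a1.le a2.le, div_lt_iff₀ (Real.rpow_pos_of_pos a2 β)] at h3
    exact h3.le

/-- The four possible values of the noise lie in `[-2, 2]`. -/
lemma abs_jump_le {r y : ℝ} (hA0 : 0 ≤ pA) (hA1 : pA ≤ 1) (hB0 : 0 ≤ pB) (hB1 : pB ≤ 1)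
    (hr0 : 0 ≤ r) (hr1 : r ≤ 1) (hy0 : 0 ≤ y) (hy1 : y ≤ 1) :
    |1 - y - drift pA pB r y| ≤ 2 ∧ |-(r * y) - drift pA pB r y| ≤ 2 ∧
      |-y - drift pA pB r y| ≤ 2 ∧ |r * (1 - y) - drift pA pB r y| ≤ 2 := by
  have hd := abs_le.1 (abs_drift_le hA0 hA1 hB0 hB1 hr0 hr1 hy0 hy1)
  have h1 : 0 ≤ r * y := mul_nonneg hr0 hy0
  have h2 : r * y ≤ 1 := mul_le_one₀ hr1 hy0 hy1
  have h3 : 0 ≤ r * (1 - y) := mul_nonneg hr0 (by linarith)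
  have h4 : r * (1 - y) ≤ 1 := mul_le_one₀ hr1 (by linarith) (by linarith)
  simp only [abs_le]
  refine ⟨⟨?_, ?_⟩, ⟨?_, ?_⟩, ⟨?_, ?_⟩, ?_, ?_⟩ <;> linarith

lemma abs_filteredNoise_le (hr : IsRate γ ρ)
    (hA0 : 0 ≤ pA) (hA1 : pA ≤ 1) (hB0 : 0 ≤ pB) (hB1 : pB ≤ 1) (hx0 : 0 ≤ x) (hx1 : x ≤ 1)
    (hc : IsControlledFrom γ ρ β n₀) {n : ℕ} (hn : n₀ ≤ n) (ω : Ω) :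
    |filteredNoise γ ρ U A B pA pB x β n₀ n ω| ≤ 2 := by
  induction n, hn using Nat.le_induction with
  | base => rw [filteredNoise, noiseFilter_of_le le_rfl]; norm_num
  | succ n hn ih =>
    have e := filteredNoise_succ (pA := pA) (pB := pB) (x := x) (U := U) (A := A)
      (B := B) (β := β) hr hn 1 ω
    have g0 := hr.γ_pos (n + 1) (by omega)
    have g1 := hr.γ_lt_one (n + 1) (by omega)
    obtain ⟨y0, y1⟩ := X_mem_Icc (U := U) (A := A) (B := B) hr hx0 hx1 n ω
    obtain ⟨b1, b2, b3, b4⟩ := abs_jump_le hA0 hA1 hB0 hB1 (hr.ρ_pos (n + 1) (by omega)).le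
      (hc.ρ_le n hn) y0 y1
    simp only [one_mul] at e
    rw [e]
    have hstep : ∀ t : ℝ, |t| ≤ 2 → ∀ P : Prop, ∀ _ : Decidable P,
        |(1 - γ (n + 1)) * filteredNoise γ ρ U A B pA pB x β n₀ n ω
          + (if P then γ (n + 1) else 0) * t| ≤ 2 := by
      intro t ht P _
      rw [abs_le] at ih ht ⊢
      split_ifs <;> constructor <;> nlinarith
    rcases outcome_cases U A B n (X γ ρ U A B x n) ω with hc | hc | hc | hc <;> rw [hc]
    · exact hstep _ b1 _ _
    · exact hstep _ b2 _ _
    · exact hstep _ b3 _ _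
    · exact hstep _ b4 _ _

variable [MeasurableSpace Ω] {μ : Measure Ω}

lemma IsInput.measurable_filteredNoise (h : IsInput μ U A B pA pB) (hr : IsRate γ ρ) (n : ℕ) :
    Measurable (filteredNoise γ ρ U A B pA pB x β n₀ n) :=
  (LRP.measurable_filteredNoise hr β n₀ n).mono (h.pastSigma_le n) le_rfl

variable [IsProbabilityMeasure μ]

/-- The filtered noise has sub-Gaussian exponential moments with variance proxy of order
`γ n * ρ n ^ β`, for arguments up to the order of `1 / γ n`. -/
lemma IsInput.integral_exp_filteredNoise_le (h : IsInput μ U A B pA pB) (hr : IsRate γ ρ)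
    (hA0 : 0 ≤ pA) (hA1 : pA ≤ 1) (hB0 : 0 ≤ pB) (hB1 : pB ≤ 1) (hx0 : 0 ≤ x) (hx1 : x ≤ 1)
    (hβ1 : β ≤ 1) (hc : IsControlledFrom γ ρ β n₀) {n : ℕ} (hn : n₀ ≤ n) :
    ∀ c : ℝ, |c| * γ n ≤ 1 / 2 →
      ∫ ω, Real.exp (c * filteredNoise γ ρ U A B pA pB x β n₀ n ω) ∂μ
        ≤ Real.exp (6 * c ^ 2 * (γ n * ρ n ^ β)) := by
  induction n, hn using Nat.le_induction with
  | base =>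
    intro c _
    have e : ∀ ω, filteredNoise γ ρ U A B pA pB x β n₀ n₀ ω = 0 := fun ω =>
      noiseFilter_of_le le_rfl
    have g0 := hr.γ_pos n₀ hc.one_le
    have p := Real.rpow_pos_of_pos (hr.ρ_pos n₀ hc.one_le) β
    simp only [e, mul_zero, Real.exp_zero]
    rw [integral_const]
    simpa using by positivity
  | succ n hn ih =>
    intro c hcγ
    have hn1 := hc.one_le.trans hn
    have g := hr.γ_pos n hn1
    have g0 := hr.γ_pos (n + 1) (by omega)
    have g1 := hr.γ_lt_one (n + 1) (by omega)
    have r0 := hr.ρ_pos (n + 1) (by omega)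
    have r1 := hc.ρ_le n hn
    have p := Real.rpow_pos_of_pos r0 β
    have hX := measurable_X γ ρ U A B x n
    have hd := (measurable_drift pA pB (ρ (n + 1))).comp hX
    set t : Ω → ℝ := fun ω => if X γ ρ U A B x n ω * (1 - X γ ρ U A B x n ω) ≤ ρ n ^ β
      then c * γ (n + 1) else 0 with ht
    have htm : Measurable[pastSigma U A B n] t :=
      Measurable.ite (measurableSet_le (hX.mul (measurable_const.sub hX)) measurable_const)
        measurable_const measurable_const
    have htb : ∀ ω, |t ω| ≤ 1 / 2 := fun ω => by
      simp only [ht]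
      split_ifs
      · rwa [abs_mul, abs_of_pos g0]
      · norm_num
    have hY : ∀ ω, 0 ≤ X γ ρ U A B x n ω ∧ X γ ρ U A B x n ω ≤ 1 := X_mem_Icc hr hx0 hx1 n
    have hjump := fun ω => abs_jump_le hA0 hA1 hB0 hB1 r0.le r1 (hY ω).1 (hY ω).2
    have hmul : ∀ ω s, |s| ≤ 2 → |t ω * s| ≤ 1 := fun ω s hs => by
      rw [abs_mul]
      calc |t ω| * |s| ≤ 1 / 2 * 2 := mul_le_mul (htb ω) hs (abs_nonneg _) (by norm_num)
        _ = 1 := by norm_num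
    set V : Ω → ℝ := fun ω =>
      Real.exp (c * (1 - γ (n + 1)) * filteredNoise γ ρ U A B pA pB x β n₀ n ω) with hV
    have hVm : Measurable[pastSigma U A B n] V :=
      ((LRP.measurable_filteredNoise hr β n₀ n).const_mul _).exp
    have hVb : ∀ ω, V ω ≤ Real.exp (|c * (1 - γ (n + 1))| * 2) := fun ω => by
      refine Real.exp_le_exp.2 ((le_abs_self _).trans ?_)
      rw [abs_mul]
      exact mul_le_mul_of_nonneg_left
        (abs_filteredNoise_le hr hA0 hA1 hB0 hB1 hx0 hx1 hc hn ω) (abs_nonneg _)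
    have hone := h.integral_mul_exp_outcome_le (Y := X γ ρ U A B x n)
      (v₁ := fun ω => t ω * (1 - X γ ρ U A B x n ω
        - drift pA pB (ρ (n + 1)) (X γ ρ U A B x n ω)))
      (v₂ := fun ω => t ω * (-(ρ (n + 1) * X γ ρ U A B x n ω)
        - drift pA pB (ρ (n + 1)) (X γ ρ U A B x n ω)))
      (v₃ := fun ω => t ω * (-X γ ρ U A B x n ω
        - drift pA pB (ρ (n + 1)) (X γ ρ U A B x n ω)))
      (v₄ := fun ω => t ω * (ρ (n + 1) * (1 - X γ ρ U A B x n ω)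
        - drift pA pB (ρ (n + 1)) (X γ ρ U A B x n ω)))
      (q := 3 * c ^ 2 * γ (n + 1) ^ 2 * ρ (n + 1) ^ β)
      hVm hX (htm.mul ((measurable_const.sub hX).sub hd))
      (htm.mul ((hX.const_mul _).neg.sub hd)) (htm.mul (hX.neg.sub hd))
      (htm.mul (((measurable_const.sub hX).const_mul _).sub hd))
      (fun ω => (Real.exp_pos _).le) hVb (fun ω => (hY ω).1) (fun ω => (hY ω).2)
      (fun ω => hmul ω _ (hjump ω).1) (fun ω => hmul ω _ (hjump ω).2.1)
      (fun ω => hmul ω _ (hjump ω).2.2.1) (fun ω => hmul ω _ (hjump ω).2.2.2)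
      (fun ω => by
        have := mean_jump_eq_zero (pA := pA) (pB := pB) (r := ρ (n + 1)) (y := X γ ρ U A B x n ω)
        linear_combination t ω * this)
      (fun ω => by
        have hv := variance_jump_le (r := ρ (n + 1)) hA0 hA1 hB0 hB1 (hY ω).1 (hY ω).2
        have hρ2 : ρ (n + 1) ^ 2 ≤ ρ (n + 1) ^ β := by
          rw [← Real.rpow_natCast]
          exact Real.rpow_le_rpow_of_exponent_ge r0 r1 (by push_cast; linarith)
        have hρβ := hc.rpow_le n hn
        by_cases hle : X γ ρ U A B x n ω * (1 - X γ ρ U A B x n ω) ≤ ρ n ^ β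
        · have htω : t ω = c * γ (n + 1) := if_pos hle
          rw [htω]
          have := mul_le_mul_of_nonneg_left (hv.trans (by linarith :
            X γ ρ U A B x n ω * (1 - X γ ρ U A B x n ω) + ρ (n + 1) ^ 2 ≤ 3 * ρ (n + 1) ^ β))
            (sq_nonneg (c * γ (n + 1)))
          linarith
        · have htω : t ω = 0 := if_neg hle
          rw [htω]
          have : 0 ≤ 3 * c ^ 2 * γ (n + 1) ^ 2 * ρ (n + 1) ^ β := by positivity
          simpa using this)
    -- contraction of the filter compensates the growth of the admissible range `1 / (2 γ n)`
    have hcγ' : |c * (1 - γ (n + 1))| * γ n ≤ 1 / 2 := by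
      have h1 := hc.γ_le n hn
      have h2 : (1 - γ (n + 1)) * γ n ≤ γ (n + 1) := by nlinarith
      rw [abs_mul, abs_of_pos (by linarith : 0 < 1 - γ (n + 1)), mul_assoc]
      exact (mul_le_mul_of_nonneg_left h2 (abs_nonneg c)).trans hcγ
    calc ∫ ω, Real.exp (c * filteredNoise γ ρ U A B pA pB x β n₀ (n + 1) ω) ∂μ
        ≤ Real.exp (3 * c ^ 2 * γ (n + 1) ^ 2 * ρ (n + 1) ^ β) * ∫ ω, V ω ∂μ := by
          refine le_of_eq_of_le (integral_congr_ae (Eventually.of_forall fun ω => ?_)) hone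
          beta_reduce
          rw [filteredNoise_succ hr hn, Real.exp_add]
      _ ≤ Real.exp (3 * c ^ 2 * γ (n + 1) ^ 2 * ρ (n + 1) ^ β)
          * Real.exp (6 * (c * (1 - γ (n + 1))) ^ 2 * (γ n * ρ n ^ β)) := by
          gcongr
          exact ih _ hcγ'
      _ ≤ Real.exp (6 * c ^ 2 * (γ (n + 1) * ρ (n + 1) ^ β)) := by
          rw [← Real.exp_add]
          refine Real.exp_le_exp.2 ?_
          have h1 := hc.γρ_le n hn
          have h2 : (1 - γ (n + 1)) ^ 2 * (1 + γ (n + 1) / 2) ≤ 1 - γ (n + 1) / 2 := by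
            nlinarith [mul_pos g0 g0, mul_pos (mul_pos g0 g0) g0]
          have h3 : (1 - γ (n + 1)) ^ 2 * (γ n * ρ n ^ β)
              ≤ γ (n + 1) * ρ (n + 1) ^ β * (1 - γ (n + 1) / 2) := by
            calc (1 - γ (n + 1)) ^ 2 * (γ n * ρ n ^ β)
                ≤ (1 - γ (n + 1)) ^ 2 * (γ (n + 1) * ρ (n + 1) ^ β * (1 + γ (n + 1) / 2)) := by
                  gcongr
              _ = γ (n + 1) * ρ (n + 1) ^ β
                  * ((1 - γ (n + 1)) ^ 2 * (1 + γ (n + 1) / 2)) := by ring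
              _ ≤ _ := by gcongr
          have h4 := mul_le_mul_of_nonneg_left h3 (sq_nonneg c)
          linarith

/-- Chernoff bound for the filtered noise at scale `ρ n ^ β'`. -/
lemma IsInput.measureReal_filteredNoise_le (h : IsInput μ U A B pA pB) (hr : IsRate γ ρ)
    (hA0 : 0 ≤ pA) (hA1 : pA ≤ 1) (hB0 : 0 ≤ pB) (hB1 : pB ≤ 1) (hx0 : 0 ≤ x) (hx1 : x ≤ 1)
    (hβ1 : β ≤ 1) (hc : IsControlledFrom γ ρ β n₀) {β' η ε : ℝ} (hββ' : β ≤ β')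
    (hη : 2 * β' - β ≤ 1 + η) (hε : 0 < ε) :
    ∃ K : ℝ, 0 < K ∧ ∀ n, n₀ ≤ n →
      μ.real {ω | ε * ρ (n + 1) ^ β' ≤ |filteredNoise γ ρ U A B pA pB x β n₀ (n + 1) ω|}
        ≤ 2 * Real.exp (-K * (ρ (n + 1) ^ (1 + η) / γ (n + 1))) := by
  -- the exponential Markov inequality is applied with argument `s ρ ^ (β' - β) / γ`
  obtain ⟨s, hs0, hs1, hs2⟩ : ∃ s : ℝ, 0 < s ∧ s ≤ 1 / 2 ∧ s ≤ ε / 12 :=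
    ⟨min (1 / 2) (ε / 12), lt_min (by norm_num) (by linarith), min_le_left _ _, min_le_right _ _⟩
  refine ⟨s * ε / 2, by positivity, fun n hn => ?_⟩
  have g0 := hr.γ_pos (n + 1) (by omega)
  have r0 := hr.ρ_pos (n + 1) (by omega)
  have r1 := hc.ρ_le n hn
  set N := filteredNoise γ ρ U A B pA pB x β n₀ (n + 1) with hN
  have hNm : Measurable N := h.measurable_filteredNoise hr (n + 1)
  set l : ℝ := s * ρ (n + 1) ^ (β' - β) / γ (n + 1) with hl
  have hp : ρ (n + 1) ^ (β' - β) ≤ 1 := Real.rpow_le_one r0.le r1 (by linarith)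
  have hp0 := Real.rpow_pos_of_pos r0 (β' - β)
  have hl0 : 0 < l := by positivity
  have hlγ : |l| * γ (n + 1) ≤ 1 / 2 := by
    rw [abs_of_pos hl0, hl, div_mul_cancel₀ _ g0.ne']
    nlinarith
  have hexpo : -(l * (ε * ρ (n + 1) ^ β')) + 6 * l ^ 2 * (γ (n + 1) * ρ (n + 1) ^ β)
      ≤ -(s * ε / 2) * (ρ (n + 1) ^ (1 + η) / γ (n + 1)) := by
    have e1 : ρ (n + 1) ^ (β' - β) * ρ (n + 1) ^ β' = ρ (n + 1) ^ (2 * β' - β) := by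
      rw [← Real.rpow_add r0]; ring_nf
    have e2 : ρ (n + 1) ^ (β' - β) * ρ (n + 1) ^ (β' - β) * ρ (n + 1) ^ β
        = ρ (n + 1) ^ (2 * β' - β) := by
      rw [← Real.rpow_add r0, ← Real.rpow_add r0]; ring_nf
    have e3 : -(l * (ε * ρ (n + 1) ^ β')) + 6 * l ^ 2 * (γ (n + 1) * ρ (n + 1) ^ β)
        = -(s * ε - 6 * s ^ 2) * (ρ (n + 1) ^ (2 * β' - β) / γ (n + 1)) := by
      have e4 : l * (ε * ρ (n + 1) ^ β')
          = s * ε * (ρ (n + 1) ^ (β' - β) * ρ (n + 1) ^ β') / γ (n + 1) := by rw [hl]; ring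
      have e5 : 6 * l ^ 2 * (γ (n + 1) * ρ (n + 1) ^ β)
          = 6 * s ^ 2 * (ρ (n + 1) ^ (β' - β) * ρ (n + 1) ^ (β' - β) * ρ (n + 1) ^ β)
            / γ (n + 1) := by rw [hl]; field_simp
      rw [e4, e5, e1, e2]
      ring
    have e6 : ρ (n + 1) ^ (1 + η) / γ (n + 1) ≤ ρ (n + 1) ^ (2 * β' - β) / γ (n + 1) :=
      div_le_div_of_nonneg_right (Real.rpow_le_rpow_of_exponent_ge r0 r1 hη) g0.le
    have e7 : 0 < ρ (n + 1) ^ (1 + η) / γ (n + 1) := div_pos (Real.rpow_pos_of_pos r0 _) g0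
    have e8 : s * ε / 2 ≤ s * ε - 6 * s ^ 2 := by nlinarith
    rw [e3]
    have e9 : 0 < s * ε / 2 := by positivity
    nlinarith
  have htail : ∀ c : ℝ, |c| = l → ∀ S : Set Ω,
      (∀ ω ∈ S, l * (ε * ρ (n + 1) ^ β') ≤ c * N ω) →
      μ.real S ≤ Real.exp (-(s * ε / 2) * (ρ (n + 1) ^ (1 + η) / γ (n + 1))) := by
    intro c hcl S hS
    have hint : Integrable (fun ω => Real.exp (c * N ω)) μ := by
      refine integrable_of_bounded (hNm.const_mul c).exp (C := Real.exp (l * 2)) fun ω => ?_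
      rw [Real.abs_exp]
      refine Real.exp_le_exp.2 ((le_abs_self _).trans ?_)
      rw [abs_mul, hcl]
      exact mul_le_mul_of_nonneg_left
        (abs_filteredNoise_le hr hA0 hA1 hB0 hB1 hx0 hx1 hc (by omega) ω) hl0.le
    have hm := mul_meas_ge_le_integral_of_nonneg (μ := μ)
      (Eventually.of_forall fun ω => (Real.exp_pos (c * N ω)).le) hint
      (Real.exp (l * (ε * ρ (n + 1) ^ β')))
    have hmgf := h.integral_exp_filteredNoise_le hr hA0 hA1 hB0 hB1 hx0 hx1 hβ1 hc
      (n := n + 1) (by omega) c (by rwa [hcl, ← abs_of_pos hl0])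
    have hc2 : c ^ 2 = l ^ 2 := by rw [← hcl, sq_abs]
    rw [hc2] at hmgf
    calc μ.real S ≤ μ.real {ω | Real.exp (l * (ε * ρ (n + 1) ^ β')) ≤ Real.exp (c * N ω)} :=
          measureReal_mono fun ω hω => Real.exp_le_exp.2 (hS ω hω)
      _ = Real.exp (-(l * (ε * ρ (n + 1) ^ β'))) * (Real.exp (l * (ε * ρ (n + 1) ^ β'))
          * μ.real {ω | Real.exp (l * (ε * ρ (n + 1) ^ β')) ≤ Real.exp (c * N ω)}) := by
          rw [← mul_assoc (Real.exp _) (Real.exp _), ← Real.exp_add, neg_add_cancel,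
            Real.exp_zero, one_mul]
      _ ≤ Real.exp (-(l * (ε * ρ (n + 1) ^ β')))
          * Real.exp (6 * l ^ 2 * (γ (n + 1) * ρ (n + 1) ^ β)) := by
          gcongr
          exact hm.trans hmgf
      _ ≤ _ := by
          rw [← Real.exp_add]
          exact Real.exp_le_exp.2 hexpo
  have hsub : {ω | ε * ρ (n + 1) ^ β' ≤ |N ω|}
      ⊆ {ω | ε * ρ (n + 1) ^ β' ≤ N ω} ∪ {ω | ε * ρ (n + 1) ^ β' ≤ -N ω} := by
    intro ω hω
    exact le_abs.1 (show ε * ρ (n + 1) ^ β' ≤ |N ω| from hω)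
  calc μ.real {ω | ε * ρ (n + 1) ^ β' ≤ |N ω|}
      ≤ μ.real {ω | ε * ρ (n + 1) ^ β' ≤ N ω} + μ.real {ω | ε * ρ (n + 1) ^ β' ≤ -N ω} :=
        (measureReal_mono hsub).trans (measureReal_union_le _ _)
    _ ≤ Real.exp (-(s * ε / 2) * (ρ (n + 1) ^ (1 + η) / γ (n + 1)))
        + Real.exp (-(s * ε / 2) * (ρ (n + 1) ^ (1 + η) / γ (n + 1))) := by
        refine add_le_add (htail l (abs_of_pos hl0) _ fun ω hω => ?_)
          (htail (-l) (by rw [abs_neg, abs_of_pos hl0]) _ fun ω hω => ?_)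
        · exact mul_le_mul_of_nonneg_left hω hl0.le
        · rw [neg_mul_comm]
          exact mul_le_mul_of_nonneg_left hω hl0.le
    _ = _ := by ring

/-- Almost surely the filtered noise is negligible at scale `ρ n ^ β'`. -/
lemma IsInput.ae_tendsto_filteredNoise (h : IsInput μ U A B pA pB) (hr : IsRate γ ρ)
    (hA0 : 0 ≤ pA) (hA1 : pA ≤ 1) (hB0 : 0 ≤ pB) (hB1 : pB ≤ 1) (hx0 : 0 ≤ x) (hx1 : x ≤ 1)
    (hβ1 : β ≤ 1) (hc : IsControlledFrom γ ρ β n₀) {β' η : ℝ} (hββ' : β ≤ β')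
    (hη : 2 * β' - β ≤ 1 + η) (hsum : ∀ c : ℝ, 0 < c →
      Summable (fun n : ℕ => Real.exp (-c * (ρ (n + 1) ^ (1 + η) / γ (n + 1))))) :
    ∀ᵐ ω ∂μ, Tendsto (fun n => filteredNoise γ ρ U A B pA pB x β n₀ n ω / ρ n ^ β') atTop
      (𝓝 0) := by
  have hε : ∀ k : ℕ, ∀ᵐ ω ∂μ, ∀ᶠ n in atTop,
      |filteredNoise γ ρ U A B pA pB x β n₀ (n + 1) ω| < 1 / ((k : ℝ) + 1) * ρ (n + 1) ^ β' := by
    intro k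
    obtain ⟨K, hK, hbound⟩ := h.measureReal_filteredNoise_le hr hA0 hA1 hB0 hB1 hx0 hx1 hβ1 hc
      hββ' hη (show 0 < 1 / ((k : ℝ) + 1) by positivity)
    set S : ℕ → Set Ω := fun n => {ω | 1 / ((k : ℝ) + 1) * ρ (n + 1) ^ β'
      ≤ |filteredNoise γ ρ U A B pA pB x β n₀ (n + 1) ω|} with hS
    have hsum' : Summable fun n => μ.real (S n) := by
      rw [← summable_nat_add_iff n₀]
      refine Summable.of_nonneg_of_le (fun n => measureReal_nonneg)
        (fun n => hbound (n + n₀) (by omega)) ?_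
      exact (summable_nat_add_iff n₀).2 ((hsum K hK).mul_left 2)
    have hfin : ∑' n, μ (S n) ≠ ⊤ := by
      have e : ∀ n, μ (S n) = ENNReal.ofReal (μ.real (S n)) := fun n => by simp
      simp only [e]
      exact hsum'.tsum_ofReal_ne_top
    filter_upwards [ae_eventually_notMem hfin] with ω hω
    filter_upwards [hω] with n hn
    exact not_le.1 hn
  filter_upwards [ae_all_iff.2 hε] with ω hω
  rw [← tendsto_add_atTop_iff_nat 1, Metric.tendsto_nhds]
  intro ε hε0
  obtain ⟨k, hk⟩ := exists_nat_one_div_lt hε0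
  filter_upwards [hω k] with n hn
  have p := Real.rpow_pos_of_pos (hr.ρ_pos (n + 1) (by omega)) β'
  rw [Real.dist_eq, sub_zero, abs_div, abs_of_pos p, div_lt_iff₀ p]
  exact hn.trans (mul_lt_mul_of_pos_right hk p)

end Concentration

section Convergence

variable {Ω : Type*} [MeasurableSpace Ω] {μ : Measure Ω} [IsProbabilityMeasure μ]
  {γ ρ : ℕ → ℝ} {U : ℕ → Ω → ℝ} {A B : ℕ → Set Ω} {pA pB x : ℝ}

/-- Almost sure rate of convergence. The bootstrap exponents are `k / (m + 1)` with
`1 / (m + 1) < η`, so that passing from one to the next satisfies `2 β' - β ≤ 1 + η`. -/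
theorem IsInput.ae_tendsto (h : IsInput μ U A B pA pB) (hB0 : 0 < pB) (hAB : pB < pA)
    (hA1 : pA < 1) (hx0 : 0 ≤ x) (hx1 : x ≤ 1) (hr : IsRate γ ρ) (hρ : RhoConditions γ ρ)
    (hreg : RegularityCondition γ ρ) (hexp : ExpSumCondition γ ρ) :
    ∀ᵐ ω ∂μ, Tendsto (fun n => (1 - X γ ρ U A B x n ω) / ρ n) atTop
      (𝓝 ((1 - pA) / (pA - pB))) := by
  obtain ⟨η, hη0, hsum⟩ := hexp
  obtain ⟨m, hm⟩ := exists_nat_one_div_lt hη0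
  have hm0 : (0 : ℝ) < ((m + 1 : ℕ) : ℝ) := by positivity
  have hall : ∀ k : ℕ, ∃ n₀, k < m + 1 → ∀ᵐ ω ∂μ, Tendsto (fun n =>
      filteredNoise γ ρ U A B pA pB x ((k : ℝ) / ((m + 1 : ℕ) : ℝ)) n₀ n ω
        / ρ n ^ (((k + 1 : ℕ) : ℝ) / ((m + 1 : ℕ) : ℝ))) atTop (𝓝 0) := by
    intro k
    by_cases hk : k < m + 1
    · have hk1 : ((k : ℕ) : ℝ) + 1 ≤ ((m + 1 : ℕ) : ℝ) := by exact_mod_cast hk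
      have hβ0 : (0 : ℝ) ≤ (k : ℝ) / ((m + 1 : ℕ) : ℝ) := by positivity
      have hβ1 : (k : ℝ) / ((m + 1 : ℕ) : ℝ) ≤ 1 := by
        rw [div_le_one hm0]
        linarith
      obtain ⟨n₀, hn₀⟩ := exists_isControlledFrom hr hρ hreg hβ0 hβ1
      refine ⟨n₀, fun _ => h.ae_tendsto_filteredNoise hr (by linarith) hA1.le hB0.le (by linarith)
        hx0 hx1 hβ1 hn₀ (η := η) ?_ ?_ hsum⟩
      · push_cast
        gcongr
        linarith
      · have e : 2 * (((k + 1 : ℕ) : ℝ) / ((m + 1 : ℕ) : ℝ)) - (k : ℝ) / ((m + 1 : ℕ) : ℝ)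
            = ((k : ℝ) + 1) / ((m + 1 : ℕ) : ℝ) + 1 / ((m : ℝ) + 1) := by
          push_cast
          ring
        have : ((k : ℝ) + 1) / ((m + 1 : ℕ) : ℝ) ≤ 1 := by
          rw [div_le_one hm0]
          exact hk1
        rw [e]
        linarith
    · exact ⟨0, fun h => absurd h hk⟩
  choose n₀ hn₀ using hall
  have hae : ∀ᵐ ω ∂μ, ∀ k : ℕ, k < m + 1 → Tendsto (fun n =>
      filteredNoise γ ρ U A B pA pB x ((k : ℝ) / ((m + 1 : ℕ) : ℝ)) (n₀ k) n ω
        / ρ n ^ (((k + 1 : ℕ) : ℝ) / ((m + 1 : ℕ) : ℝ))) atTop (𝓝 0) := by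
    rw [ae_all_iff]
    intro k
    by_cases hk : k < m + 1
    · filter_upwards [hn₀ k hk] with ω hω _ using hω
    · exact Eventually.of_forall fun ω h => absurd h hk
  filter_upwards [hae] with ω hω
  refine (isPath_X (U := U) (A := A) (B := B) (pA := pA) (pB := pB) hr hx0 hx1 ω).tendsto hr hρ
    hB0 hAB hA1 (Nat.succ_pos m) fun k hk => ⟨_, ?_, hω k hk⟩
  filter_upwards [eventually_ge_atTop (n₀ k)] with n hn
  exact noiseFilter_succ hn

end Convergence

/-! ### Power rates -/

section PowerRates

lemma abs_succ_rpow_neg_sub_le {s : ℝ} (hs : 0 ≤ s) {n : ℕ} (hn : 1 ≤ n) (hsn : s ≤ n) :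
    |((n + 1 : ℕ) : ℝ) ^ (-s) - (n : ℝ) ^ (-s)| ≤ 4 * s * ((n + 1 : ℕ) : ℝ) ^ (-s - 1) := by
  have hn0 : (0 : ℝ) < n := by exact_mod_cast hn
  have hn1 : (1 : ℝ) ≤ n := by exact_mod_cast hn
  push_cast
  have hm : (0 : ℝ) < (n : ℝ) + 1 := by linarith
  have hp := Real.rpow_pos_of_pos hm (-s)
  have hanti : ((n : ℝ) + 1) ^ (-s) ≤ (n : ℝ) ^ (-s) :=
    Real.rpow_le_rpow_of_nonpos hn0 (by linarith) (by linarith)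
  have hratio : (n : ℝ) ^ (-s) = ((n : ℝ) + 1) ^ (-s) * (1 / (n : ℝ) + 1) ^ s := by
    have : (1 / (n : ℝ) + 1) = ((n : ℝ) + 1) / n := by field_simp; ring
    rw [this, Real.div_rpow hm.le hn0.le, Real.rpow_neg hn0.le, Real.rpow_neg hm.le]
    have := Real.rpow_pos_of_pos hm s
    field_simp
  have hexp : (1 / (n : ℝ) + 1) ^ s ≤ Real.exp (1 / n * s) := by
    rw [Real.exp_mul]
    exact Real.rpow_le_rpow (by positivity) (Real.add_one_le_exp _) hs
  have hx0 : 0 ≤ 1 / (n : ℝ) * s := by positivity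
  have hx1 : 1 / (n : ℝ) * s ≤ 1 := by
    rw [one_div_mul_eq_div, div_le_one hn0]
    exact hsn
  have hx2 : Real.exp (1 / n * s) - 1 ≤ 2 * (1 / n * s) := by
    have := (abs_le.1 (Real.abs_exp_sub_one_sub_id_le (by rwa [abs_of_nonneg hx0]))).2
    nlinarith
  have hx3 : 2 * (1 / (n : ℝ) * s) ≤ 4 * s * (1 / ((n : ℝ) + 1)) := by
    rw [← sub_nonneg]
    have : 4 * s * (1 / ((n : ℝ) + 1)) - 2 * (1 / (n : ℝ) * s)
        = 2 * s * (n - 1) / (n * (n + 1)) := by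
      field_simp
      ring
    rw [this]
    have : 0 ≤ (n : ℝ) - 1 := by linarith
    positivity
  rw [abs_of_nonpos (by linarith), Real.rpow_sub_one hm.ne']
  calc -(((n : ℝ) + 1) ^ (-s) - (n : ℝ) ^ (-s))
      = ((n : ℝ) + 1) ^ (-s) * ((1 / (n : ℝ) + 1) ^ s - 1) := by rw [hratio]; ring
    _ ≤ ((n : ℝ) + 1) ^ (-s) * (4 * s * (1 / ((n : ℝ) + 1))) := by
        gcongr
        linarith
    _ = 4 * s * (((n : ℝ) + 1) ^ (-s) / ((n : ℝ) + 1)) := by ring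

lemma tendsto_natCast_rpow_neg {s : ℝ} (hs : 0 < s) :
    Tendsto (fun n : ℕ => (n : ℝ) ^ (-s)) atTop (𝓝 0) :=
  (tendsto_rpow_neg_atTop hs).comp tendsto_natCast_atTop_atTop

lemma succ_rpow_neg_sub_isLittleO {s a : ℝ} (hs : 0 ≤ s) (ha : a < 1) :
    (fun n : ℕ => ((n + 1 : ℕ) : ℝ) ^ (-s) - (n : ℝ) ^ (-s))
      =o[atTop] fun n : ℕ => ((n + 1 : ℕ) : ℝ) ^ (-s - a) := by
  have h1 : (fun n : ℕ => ((n + 1 : ℕ) : ℝ) ^ (-s) - (n : ℝ) ^ (-s))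
      =O[atTop] fun n : ℕ => ((n + 1 : ℕ) : ℝ) ^ (-s - 1) := by
    refine IsBigO.of_bound (4 * s) ?_
    filter_upwards [eventually_ge_atTop 1,
      tendsto_natCast_atTop_atTop.eventually (eventually_ge_atTop s)] with n hn hsn
    rw [Real.norm_eq_abs, Real.norm_eq_abs, abs_of_nonneg (by positivity : (0 : ℝ) ≤ _ ^ (-s - 1))]
    exact abs_succ_rpow_neg_sub_le hs hn hsn
  refine h1.trans_isLittleO ?_
  rw [isLittleO_iff_tendsto' (Eventually.of_forall fun n h => absurd h (by positivity))]
  have := (tendsto_add_atTop_iff_nat 1).2 (tendsto_natCast_rpow_neg (by linarith : 0 < 1 - a))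
  refine this.congr fun n => ?_
  rw [← Real.rpow_sub (by positivity)]
  ring_nf

lemma tendsto_sum_mul_rpow_neg {K s : ℝ} (hK : 0 < K) (hs : s ≤ 1) :
    Tendsto (fun N : ℕ => ∑ n ∈ Finset.Icc 1 N, K * (n : ℝ) ^ (-s)) atTop atTop := by
  have hns : ¬ Summable fun n : ℕ => K * ((n + 1 : ℕ) : ℝ) ^ (-s) := by
    rw [summable_mul_left_iff hK.ne', summable_nat_add_iff 1 (f := fun n : ℕ => (n : ℝ) ^ (-s)),
      Real.summable_nat_rpow]
    linarith
  have := (not_summable_iff_tendsto_nat_atTop_of_nonneg fun n => by positivity).1 hns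
  refine this.congr fun N => ?_
  induction N with
  | zero => simp
  | succ k ih => rw [Finset.sum_range_succ, ih, sum_Icc_one_succ]

lemma summable_exp_neg_mul_rpow {K δ : ℝ} (hK : 0 < K) (hδ : 0 < δ) :
    Summable fun n : ℕ => Real.exp (-K * ((n + 1 : ℕ) : ℝ) ^ δ) := by
  refine (summable_nat_add_iff 1 (f := fun n : ℕ => Real.exp (-K * (n : ℝ) ^ δ))).2 ?_
  have h1 := (isLittleO_exp_neg_mul_rpow_atTop hK (-2 / δ)).isBigO.comp_tendsto
    ((tendsto_rpow_atTop hδ).comp tendsto_natCast_atTop_atTop)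
  refine summable_of_isBigO_nat (Real.summable_nat_rpow.2 (by norm_num : (-2 : ℝ) < -1))
    (h1.congr_right fun n => ?_)
  simp only [Function.comp_apply]
  rw [← Real.rpow_mul (Nat.cast_nonneg n)]
  congr 1
  field_simp

variable {C C' a r : ℝ} {γ ρ : ℕ → ℝ}

lemma mul_rpow_power_rates (hC' : 0 < C') (hγ : ∀ n : ℕ, 1 ≤ n → γ n = C * (n : ℝ) ^ (-a))
    (hρ : ∀ n : ℕ, 1 ≤ n → ρ n = C' * (n : ℝ) ^ (-r)) (β : ℝ) {n : ℕ} (hn : 1 ≤ n) :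
    γ n * ρ n ^ β = C * C' ^ β * (n : ℝ) ^ (-(a + r * β)) := by
  have hn0 : (0 : ℝ) < n := by exact_mod_cast hn
  rw [hγ n hn, hρ n hn, Real.mul_rpow hC'.le (by positivity), ← Real.rpow_mul hn0.le,
    show -(a + r * β) = -a + -r * β by ring, Real.rpow_add hn0]
  ring

lemma rhoConditions_power (hC : 0 < C) (hC' : 0 < C') (hr : 0 < r) (hra : r < a)
    (har : a + r < 1) (hγ : ∀ n : ℕ, 1 ≤ n → γ n = C * (n : ℝ) ^ (-a))
    (hρ : ∀ n : ℕ, 1 ≤ n → ρ n = C' * (n : ℝ) ^ (-r)) : RhoConditions γ ρ where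
  tendsto_ρ := by
    have := (tendsto_natCast_rpow_neg hr).const_mul C'
    rw [mul_zero] at this
    exact this.congr' ((eventually_ge_atTop 1).mono fun n hn => (hρ n hn).symm)
  tendsto_ratio := by
    have := (tendsto_natCast_rpow_neg (by linarith : 0 < a - r)).const_mul (C / C')
    rw [mul_zero] at this
    refine this.congr' ((eventually_ge_atTop 1).mono fun n hn => ?_)
    have hn0 : (0 : ℝ) < n := by exact_mod_cast hn
    beta_reduce
    rw [hγ n hn, hρ n hn, mul_div_mul_comm, ← Real.rpow_sub hn0]
    ring_nf
  sum_ργ := by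
    refine (tendsto_sum_mul_rpow_neg (mul_pos hC hC') har.le).congr fun N => ?_
    refine Finset.sum_congr rfl fun n hn => ?_
    have := mul_rpow_power_rates hC' hγ hρ 1 (Finset.mem_Icc.1 hn).1
    rw [Real.rpow_one, Real.rpow_one, mul_one] at this
    rw [mul_comm (ρ n), this]
  ρ_increment := by
    have h := ((succ_rpow_neg_sub_isLittleO hr.le (by linarith : a < 1)).const_mul_left
      C').const_mul_right (mul_pos hC hC').ne'
    refine h.congr' ?_ (Eventually.of_forall fun n => ?_)
    · filter_upwards [eventually_ge_atTop 1] with n hn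
      rw [hρ n hn, hρ (n + 1) (by omega)]
      ring
    · have := mul_rpow_power_rates hC' hγ hρ 1 (n := n + 1) (by omega)
      rw [Real.rpow_one, Real.rpow_one, mul_one] at this
      beta_reduce
      rw [mul_comm (ρ _), this]
      ring_nf

lemma regularityCondition_power (hC : 0 < C) (hC' : 0 < C') (hr : 0 < r) (hra : r < a)
    (har : a + r < 1) (hγ : ∀ n : ℕ, 1 ≤ n → γ n = C * (n : ℝ) ^ (-a))
    (hρ : ∀ n : ℕ, 1 ≤ n → ρ n = C' * (n : ℝ) ^ (-r)) : RegularityCondition γ ρ := by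
  intro β hβ
  have hs : 0 ≤ a + r * β := by
    have := mul_nonneg hr.le hβ.1
    linarith
  have hCβ : 0 < C' ^ β := Real.rpow_pos_of_pos hC' β
  have h := ((succ_rpow_neg_sub_isLittleO hs (by linarith : a < 1)).const_mul_left
    (C * C' ^ β)).const_mul_right (mul_pos hC (mul_pos hC hCβ)).ne'
  refine h.congr' ?_ (Eventually.of_forall fun n => ?_)
  · filter_upwards [eventually_ge_atTop 1] with n hn
    rw [mul_rpow_power_rates hC' hγ hρ β hn,
      mul_rpow_power_rates hC' hγ hρ β (by omega : 1 ≤ n + 1)]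
    ring
  · have hn0 : (0 : ℝ) < ((n + 1 : ℕ) : ℝ) := by positivity
    beta_reduce
    rw [pow_two, mul_assoc (γ _), mul_rpow_power_rates hC' hγ hρ β (by omega : 1 ≤ n + 1),
      hγ (n + 1) (by omega), sub_eq_add_neg, Real.rpow_add hn0]
    ring

lemma expSumCondition_power (hC : 0 < C) (hC' : 0 < C') (hr : 0 < r) (hra : r < a)
    (hγ : ∀ n : ℕ, 1 ≤ n → γ n = C * (n : ℝ) ^ (-a))
    (hρ : ∀ n : ℕ, 1 ≤ n → ρ n = C' * (n : ℝ) ^ (-r)) : ExpSumCondition γ ρ := by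
  -- this choice makes `r (1 + η)` the midpoint of `r` and `a`
  set η : ℝ := (a - r) / (2 * r) with hη
  have hη0 : 0 < η := div_pos (by linarith) (by linarith)
  refine ⟨η, hη0, fun c hc => ?_⟩
  have hCη : 0 < C' ^ (1 + η) := Real.rpow_pos_of_pos hC' _
  refine (summable_exp_neg_mul_rpow (K := c * (C' ^ (1 + η) / C)) (δ := (a - r) / 2)
    (by positivity) (by linarith)).congr fun n => ?_
  have hn0 : (0 : ℝ) < ((n + 1 : ℕ) : ℝ) := by positivity
  rw [hγ (n + 1) (by omega), hρ (n + 1) (by omega), Real.mul_rpow hC'.le (by positivity),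
    ← Real.rpow_mul hn0.le, mul_div_mul_comm, ← Real.rpow_sub hn0]
  have e : -r * (1 + η) - -a = (a - r) / 2 := by
    rw [hη]
    field_simp
    ring
  rw [e]
  ring_nf

lemma isRate_power (hC : 0 < C) (hC' : 0 < C') (hr : 0 < r) (hra : r < a)
    (har : a + r < 1) (hγ : ∀ n : ℕ, 1 ≤ n → γ n = C * (n : ℝ) ^ (-a))
    (hρ : ∀ n : ℕ, 1 ≤ n → ρ n = C' * (n : ℝ) ^ (-r)) (hC1 : C < 1) (hCC' : C * C' < 1) :
    IsRate γ ρ where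
  γ_pos n hn := by
    rw [hγ n hn]
    have hn0 : (0 : ℝ) < n := by exact_mod_cast hn
    positivity
  γ_lt_one n hn := by
    rw [hγ n hn]
    have : (n : ℝ) ^ (-a) ≤ 1 := Real.rpow_le_one_of_one_le_of_nonpos (by exact_mod_cast hn)
      (by linarith)
    nlinarith
  γ_anti m n hm hmn := by
    have hm0 : (0 : ℝ) < m := by exact_mod_cast hm
    rw [hγ n (hm.trans hmn), hγ m hm]
    exact mul_le_mul_of_nonneg_left
      (Real.rpow_le_rpow_of_nonpos hm0 (by exact_mod_cast hmn) (by linarith)) hC.le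
  sum_γ := by
    refine (tendsto_sum_mul_rpow_neg hC (by linarith : a ≤ 1)).congr fun N => ?_
    exact Finset.sum_congr rfl fun n hn => (hγ n (Finset.mem_Icc.1 hn).1).symm
  sum_exp ϑ hϑ := by
    refine (summable_exp_neg_mul_rpow (K := ϑ / C) (δ := a) (by positivity) (by linarith)).congr
      fun n => ?_
    have hn0 : (0 : ℝ) < ((n + 1 : ℕ) : ℝ) := by positivity
    rw [hγ (n + 1) (by omega), Real.rpow_neg hn0.le]
    have := Real.rpow_pos_of_pos hn0 a
    field_simp
  ρ_pos n hn := by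
    rw [hρ n hn]
    have hn0 : (0 : ℝ) < n := by exact_mod_cast hn
    positivity
  γρ_lt_one n hn := by
    have h := mul_rpow_power_rates hC' hγ hρ 1 hn
    rw [Real.rpow_one, Real.rpow_one, mul_one] at h
    rw [h]
    have : (n : ℝ) ^ (-(a + r)) ≤ 1 :=
      Real.rpow_le_one_of_one_le_of_nonpos (by exact_mod_cast hn) (by linarith)
    have hCC : 0 < C * C' := mul_pos hC hC'
    nlinarith

end PowerRates

end LRP

theorem mainTheorem4 :
    (∀ {Ω : Type*} [MeasurableSpace Ω] (μ : Measure Ω) [IsProbabilityMeasure μ]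
      (U : ℕ → Ω → ℝ) (A B : ℕ → Set Ω) (pA pB : ℝ) (γ ρ : ℕ → ℝ) (x : ℝ),
      0 < pB → pB < pA → pA < 1 → 0 < x → x < 1 →
      LRP.IsInput μ U A B pA pB →
      LRP.IsRate γ ρ →
      LRP.RhoConditions γ ρ →
      LRP.RegularityCondition γ ρ →
      LRP.ExpSumCondition γ ρ →
      ∀ᵐ ω ∂μ, Tendsto (fun n => (1 - LRP.X γ ρ U A B x n ω) / ρ n) atTop
        (𝓝 ((1 - pA) / (pA - pB)))) ∧
    (∀ (C C' a r : ℝ) (γ ρ : ℕ → ℝ), 0 < C → 0 < C' → 0 < r → r < a → a + r < 1 →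
      (∀ n : ℕ, 1 ≤ n → γ n = C * (n : ℝ) ^ (-a)) →
      (∀ n : ℕ, 1 ≤ n → ρ n = C' * (n : ℝ) ^ (-r)) →
      LRP.RhoConditions γ ρ ∧ LRP.RegularityCondition γ ρ ∧ LRP.ExpSumCondition γ ρ ∧
        (C < 1 → C * C' < 1 → LRP.IsRate γ ρ)) := by
  refine ⟨?_, ?_⟩
  · intro Ω _ μ _ U A B pA pB γ ρ x hB0 hAB hA1 hx0 hx1 h hr hρ hreg hexp
    exact h.ae_tendsto hB0 hAB hA1 hx0.le hx1.le hr hρ hreg hexp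
  · intro C C' a r γ ρ hC hC' hr hra har hγ hρ
    exact ⟨LRP.rhoConditions_power hC hC' hr hra har hγ hρ,
      LRP.regularityCondition_power hC hC' hr hra har hγ hρ,
      LRP.expSumCondition_power hC hC' hr hra hγ hρ,
      LRP.isRate_power hC hC' hr hra har hγ hρ⟩
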